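/- **Setting.** Let $n\ge 2$, $1\le k\le n-1$, and let $\Omega\subset\mathbb R^n$ be open (for instance a bounded polyhedral Lipschitz domain) with a finite simplicial subdivision $\mathcal G_h$: the cells are the closed $n$-simplices of a finite simplicial complex in which every face lies in an $n$-simplex, their union is $\overline\Omega$, and their interiors are contained in $\Omega$. Let $L^2\Lambda^j(\Omega)$ be the $j$-forms on $\Omega$ with $L^2$ coefficients, with inner product $\langle\cdot,\cdot\rangle$; let $\mathbf d$ be the exterior derivative (in the weak sense on $\Omega$), $\boldsymbol\delta$ the codifferential, i.e. the formal $L^2$-adjoint of $\mathbf d$, given by $\boldsymbol\delta\omega=-\sum_i \iota_{e_i}\partial_i\omega$, and $H\Lambda^j=\{\omega\in L^2\Lambda^j(\Omega):\mathbf d\omega\in L^2\Lambda^{j+1}(\Omega)\}$. The operators $\mathbf d_h,\boldsymbol\delta_h$ act cell by cell. For a cell $T$ let $\mathcal P_0\Lambda^j$ be the constant $j$-forms, $\boldsymbol\kappa$ the contraction with the vector field $x$, $\boldsymbol\kappa_T$ the contraction with $\tilde x=x-c_T$, where $c_T$ is the barycentre of $T$, and $\star$ the Hodge star (so $\star\boldsymbol\kappa\star$,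 $\star\boldsymbol\kappa_T\star$ are, up to sign, exterior multiplication by $\sum_i x^i\,dx^i$, $\sum_i\tilde x^i\,dx^i$). Put $$\mathcal P_1^-\Lambda^j=\mathcal P_0\Lambda^j+\boldsymbol\kappa(\mathcal P_0\Lambda^{j+1}),\qquad \mathcal P_1^{*,-}\Lambda^j=\mathcal P_0\Lambda^j+\star\boldsymbol\kappa\star(\mathcal P_0\Lambda^{j-1}),$$ $$\mathcal H^2_{\boldsymbol\delta}\Lambda^k(T)=\operatorname{span}\Big\{\sum_{j=1}^k\big[(\tilde x^{\alpha_j})^2-c^{\alpha_j}\big]dx^{\alpha_1}\wedge\dots\wedge dx^{\alpha_k}:1\le\alpha_1<\dots<\alpha_k\le n\Big\},\qquad \int_T\big[(\tilde x^{i})^2-c^{i}\big]=0,$$ $$\mathbf P\Lambda^k(T)=\mathcal P_0\Lambda^k+\boldsymbol\kappa_T(\mathcal P_0\Lambda^{k+1})+\star\boldsymbol\kappa_T\star(\mathcal P_0\Lambda^{k-1})+\mathcal H^2_{\boldsymbol\delta}\Lambda^k(T),$$ and write $\Upsilon(\mathcal G_h)$ for the space of forms on $\Omega$ whose restriction to each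 cell $T$ lies in $\Upsilon(T)$. Define $$\boldsymbol W_h\Lambda^j=\mathcal P_1^-\Lambda^j(\mathcal G_h)\cap H\Lambda^j,$$ $$\boldsymbol{\mathfrak H}_h\Lambda^k=\{\omega\in\boldsymbol W_h\Lambda^k:\mathbf d\omega=0,\ \langle\omega,\mathbf d\tau\rangle=0\ \ \forall\,\tau\in\boldsymbol W_h\Lambda^{k-1}\},$$ $$\boldsymbol W^{*,\rm abc}_{h0}\Lambda^{k+1}=\{\eta\in\mathcal P_1^{*,-}\Lambda^{k+1}(\mathcal G_h):\langle\boldsymbol\delta_h\eta,\tau\rangle-\langle\eta,\mathbf d\tau\rangle=0\ \ \forall\,\tau\in\boldsymbol W_h\Lambda^k\},$$ $$\boldsymbol V_h\Lambda^k=\Big\{\mu\in\mathbf P\Lambda^k(\mathcal G_h):\ \langle\mathbf d_h\mu,\eta\rangle-\langle\mu,\boldsymbol\delta_h\eta\rangle=0\ \ \forall\,\eta\in\boldsymbol W^{*,\rm abc}_{h0}\Lambda^{k+1},\ \ \langle\boldsymbol\delta_h\mu,\tau\rangle-\langle\mu,\mathbf d\tau\rangle=0\ \ \forall\,\tau\in\boldsymbol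 W_h\Lambda^{k-1}\Big\}.$$ **Statement.** Let $f_0\in\mathcal P_0\Lambda^k(\mathcal G_h)$. Let $(\tilde\vartheta_h,\tilde\sigma_h,\tilde\omega_h)\in\boldsymbol{\mathfrak H}_h\Lambda^k\times\boldsymbol W_h\Lambda^{k-1}\times\boldsymbol W_h\Lambda^k$ satisfy $$\begin{aligned}&\langle\tilde\omega_h,\varsigma_h\rangle=0&&\forall\,\varsigma_h\in\boldsymbol{\mathfrak H}_h\Lambda^k,\\&\langle\tilde\sigma_h,\tau_h\rangle-\langle\tilde\omega_h,\mathbf d\tau_h\rangle=0&&\forall\,\tau_h\in\boldsymbol W_h\Lambda^{k-1},\\&\langle\tilde\vartheta_h,\mu_h\rangle+\langle\mathbf d\tilde\sigma_h,\mu_h\rangle+\langle\mathbf d\tilde\omega_h,\mathbf d\mu_h\rangle=\langle f_0,\mu_h\rangle&&\forall\,\mu_h\in\boldsymbol W_h\Lambda^k,\end{aligned}$$ and let $(\bar\vartheta_h,\bar\omega_h)\in\boldsymbol{\mathfrak H}_h\Lambda^k\times\boldsymbol V_h\Lambda^k$ satisfy $$\begin{aligned}&\langle\bar\omega_h,\varsigma_h\rangle=0&&\forall\,\varsigma_h\in\boldsymbol{\mathfrak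 H}_h\Lambda^k,\\&\langle\bar\vartheta_h,\mu_h\rangle+\langle\mathbf d_h\bar\omega_h,\mathbf d_h\mu_h\rangle+\langle\boldsymbol\delta_h\bar\omega_h,\boldsymbol\delta_h\mu_h\rangle=\langle f_0,\mu_h\rangle&&\forall\,\mu_h\in\boldsymbol V_h\Lambda^k.\end{aligned}$$ Then, as $L^2$ forms on $\Omega$ (almost everywhere), $$\bar\vartheta_h=\tilde\vartheta_h,\qquad\boldsymbol\delta_h\bar\omega_h=\tilde\sigma_h,\qquad\mathbf d_h\bar\omega_h=\mathbf d\tilde\omega_h,\qquad\mathbf P_0^k\bar\omega_h=\mathbf P_0^k\tilde\omega_h,$$ where $\mathbf P_0^k$ is the $L^2$ projection onto $\mathcal P_0\Lambda^k(\mathcal G_h)$ (the cellwise mean value). -/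

import Mathlib

noncomputable section

namespace HodgeFEM

open MeasureTheory

/-! ### Differential forms on Euclidean space -/

/-- `ℝⁿ` with its Euclidean norm. -/
abbrev Euc (n : ℕ) : Type := EuclideanSpace ℝ (Fin n)

/-- The space `Altᵏ ℝⁿ` of alternating `k`-linear forms on `ℝⁿ`. -/
abbrev Alt (n k : ℕ) : Type := Euc n [⋀^Fin k]→L[ℝ] ℝ

/-- A differential `k`-form on `ℝⁿ`; a form on a subset is given by any extension. -/
abbrev Form (n k : ℕ) : Type := Euc n → Alt n k

/-- The standard basis vector `eᵢ`. -/
abbrev stdVec {n : ℕ} (i : Fin n) : Euc n := EuclideanSpace.single i (1 : ℝ)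

/-- The inner product on `Altᵏ ℝⁿ` for which the forms `dx^{α₁} ∧ ⋯ ∧ dx^{αₖ}` with
`α₁ < ⋯ < αₖ` are orthonormal. The sum runs over all index tuples; every increasing multi-index
is counted `k!` times and tuples with a repeated entry contribute zero. -/
def altInner {n k : ℕ} (a b : Alt n k) : ℝ :=
  (Nat.factorial k : ℝ)⁻¹ * ∑ f : Fin k → Fin n, a (fun i => stdVec (f i)) * b (fun i => stdVec (f i))

/-- The constant form `dx^{α₁} ∧ ⋯ ∧ dx^{αₖ}`, whose value at `(v₁, …, vₖ)` is the determinant of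
the matrix with entries `(vᵢ)_{αⱼ}`. -/
def dx {n k : ℕ} (α : Fin k → Fin n) : Alt n k :=
  { ((Matrix.detRowAlternating (n := Fin k) (R := ℝ)).compLinearMap
      ((LinearMap.funLeft ℝ ℝ α).comp (WithLp.linearEquiv 2 ℝ (Fin n → ℝ)).toLinearMap)) with
    cont := by
      change Continuous fun v : Fin k → Euc n =>
        Matrix.det (Matrix.of fun i j : Fin k => v i (α j))
      refine Continuous.matrix_det ?_
      refine continuous_pi fun i => continuous_pi fun j => ?_
      simp only [Matrix.of_apply]
      fun_prop }

/-- The codifferential, i.e. the formal `L²`-adjoint of the exterior derivative: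
`(δ ω)(v₁, …, vₖ) = - ∑ᵢ (∂ᵢ ω)(eᵢ, v₁, …, vₖ)`. The exterior derivative itself is Mathlib's
`extDeriv`. -/
def codiff {n k : ℕ} (ω : Form n (k + 1)) : Form n k := fun x =>
  -∑ i : Fin n, (fderiv ℝ ω x (stdVec i)).curryLeft (stdVec i)

/-- The Koszul operator centred at `c`, applied to a constant form: the contraction of `a` with
the vector field `x - c`. On `dx^{α₁} ∧ ⋯ ∧ dx^{αₖ}` this is
`∑ⱼ (-1)^{j+1} (x - c)_{αⱼ} dx^{α₁} ∧ ⋯ (omit dx^{αⱼ}) ⋯ ∧ dx^{αₖ}`. -/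
def koszul {n k : ℕ} (c : Euc n) (a : Alt n (k + 1)) : Form n k := fun x => a.curryLeft (x - c)

/-- The dual Koszul operator centred at `c`, applied to a constant form: exterior multiplication
by the one-form `∑ᵢ (x - c)ᵢ dxⁱ`. Up to a sign depending only on `n` and `k`, which is immaterial
for the spaces below, this is `⋆ κ ⋆ a`, with `⋆` the Hodge star and `κ` the Koszul operator. -/
def coKoszul {n k : ℕ} (c : Euc n) (a : Alt n k) : Form n (k + 1) := fun x =>
  ContinuousAlternatingMap.alternatizeUncurryFin ((innerSL ℝ (x - c)).smulRight a)

/-! ### `L²` forms and the weak exterior derivative -/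

/-- The inner product of `L²Λᵏ(Ω)`. -/
def l2Inner {n k : ℕ} (Ω : Set (Euc n)) (ω μ : Form n k) : ℝ :=
  ∫ x in Ω, altInner (ω x) (μ x)

/-- `ω` belongs to `L²Λᵏ(Ω)`. -/
def IsL2 {n k : ℕ} (Ω : Set (Euc n)) (ω : Form n k) : Prop :=
  MemLp ω 2 (volume.restrict Ω)

/-- `η` is the exterior derivative of `ω` on `Ω` in the sense of distributions. -/
def IsWeakExtDeriv {n k : ℕ} (Ω : Set (Euc n)) (ω : Form n k) (η : Form n (k + 1)) : Prop :=
  ∀ test : Form n (k + 1), ContDiff ℝ ((⊤ : ℕ∞) : WithTop ℕ∞) test → HasCompactSupport test →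
    tsupport test ⊆ Ω → l2Inner Ω ω (codiff test) = l2Inner Ω η test

/-- `HΛᵏ(Ω)`: the `L²` forms whose weak exterior derivative is an `L²` form. -/
def MemH {n k : ℕ} (Ω : Set (Euc n)) (ω : Form n k) : Prop :=
  IsL2 Ω ω ∧ ∃ η : Form n (k + 1), IsL2 Ω η ∧ IsWeakExtDeriv Ω ω η

open Classical in
/-- The operator `d` on `HΛᵏ(Ω)`: the weak exterior derivative, which is determined up to null
sets (zero for forms outside `HΛᵏ(Ω)`). -/
def weakD {n k : ℕ} (Ω : Set (Euc n)) (ω : Form n k) : Form n (k + 1) :=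
  if h : ∃ η : Form n (k + 1), IsL2 Ω η ∧ IsWeakExtDeriv Ω ω η then h.choose else 0

/-! ### Simplicial subdivisions and cellwise forms -/

/-- The geometric simplicial complex `K` is a simplicial subdivision of `Ω`: it is finite, every
face belongs to an `n`-dimensional simplex, the simplices fill the closure of `Ω`, and
the interiors of the `n`-dimensional simplices lie in `Ω` (which is automatic if `Ω` is the
interior of its closure, e.g. for a Lipschitz domain). -/
structure IsSubdivision {n : ℕ} (K : Geometry.SimplicialComplex ℝ (Euc n)) (Ω : Set (Euc n)) :
    Prop where
  finite : K.faces.Finite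
  pure : ∀ s ∈ K.faces, ∃ t ∈ K.faces, s ⊆ t ∧ t.card = n + 1
  space_eq : K.space = closure Ω
  interior_subset : ∀ t ∈ K.faces, t.card = n + 1 → interior (convexHull ℝ (t : Set (Euc n))) ⊆ Ω

/-- The cells of the subdivision: its `n`-dimensional simplices, given by their vertices. -/
def Cell {n : ℕ} (K : Geometry.SimplicialComplex ℝ (Euc n)) : Type :=
  {t : Finset (Euc n) // t ∈ K.faces ∧ t.card = n + 1}

/-- The closed simplex of a cell. -/
def Cell.carrier {n : ℕ} {K : Geometry.SimplicialComplex ℝ (Euc n)} (T : Cell K) : Set (Euc n) :=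
  convexHull ℝ (T.1 : Set (Euc n))

/-- A cellwise given `k`-form: one (globally extended) form for each cell. -/
abbrev PwForm {n : ℕ} (K : Geometry.SimplicialComplex ℝ (Euc n)) (k : ℕ) : Type :=
  Cell K → Form n k

variable {n : ℕ} {K : Geometry.SimplicialComplex ℝ (Euc n)}

/-- The form `∑_T E_T ω_T` on `Ω`, with `E_T` the extension by zero from (the interior of) `T`.
The interiors of the cells are pairwise disjoint and fill `Ω` up to a null set. -/
def glue {k : ℕ} (ω : PwForm K k) : Form n k := fun x =>
  ∑ᶠ T : Cell K, Set.indicator (interior T.carrier) (ω T) x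

/-- The cellwise exterior derivative `d_h`. -/
def dh {k : ℕ} (ω : PwForm K k) : PwForm K (k + 1) := fun T => extDeriv (ω T)

/-- The cellwise codifferential `δ_h`. -/
def deltah {k : ℕ} (ω : PwForm K (k + 1)) : PwForm K k := fun T => codiff (ω T)

/-- The product over all cells of local spaces: the cellwise forms with `ω_T ∈ Υ T` for all `T`. -/
def pwSpace {k : ℕ} (Υ : Cell K → Submodule ℝ (Form n k)) : Submodule ℝ (PwForm K k) :=
  Submodule.pi Set.univ Υ

/-- The cellwise mean value, i.e. the `L²` projection onto the piecewise constant forms. -/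
def projConst {k : ℕ} (ω : PwForm K k) : PwForm K k := fun T _ => ⨍ y in T.carrier, ω T y

/-! ### Local polynomial spaces -/

/-- The constant forms `P₀Λᵏ`. -/
def P0 (n k : ℕ) : Submodule ℝ (Form n k) :=
  Submodule.span ℝ (Set.range fun (a : Alt n k) (_ : Euc n) => a)

/-- `κ_c(P₀Λ^{k+1})`. -/
def koszulSpace {n : ℕ} (k : ℕ) (c : Euc n) : Submodule ℝ (Form n k) :=
  Submodule.span ℝ (Set.range fun a : Alt n (k + 1) => koszul c a)

/-- `⋆κ_c⋆(P₀Λᵏ)`, a space of `(k+1)`-forms. -/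
def coKoszulSpace {n : ℕ} (k : ℕ) (c : Euc n) : Submodule ℝ (Form n (k + 1)) :=
  Submodule.span ℝ (Set.range fun a : Alt n k => coKoszul c a)

/-- The local Whitney forms `P₁⁻Λᵏ = P₀Λᵏ + κ(P₀Λ^{k+1})`. -/
def P1minus (n k : ℕ) : Submodule ℝ (Form n k) := P0 n k ⊔ koszulSpace k 0

/-- The local dual Whitney forms `P₁^{*,-}Λ^{k+1} = P₀Λ^{k+1} + ⋆κ⋆(P₀Λᵏ)`. -/
def P1starMinus (n k : ℕ) : Submodule ℝ (Form n (k + 1)) := P0 n (k + 1) ⊔ coKoszulSpace k 0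

/-- The point `c_T` for which the coordinates `x̃ = x - c_T` have mean value zero on `T`. -/
def Cell.center (T : Cell K) : Euc n := ⨍ x in T.carrier, x

/-- The function `∑ⱼ ((x̃^{αⱼ})² - c^{αⱼ})`, where `c^{αⱼ}` is the mean value of `(x̃^{αⱼ})²`
over `T`. -/
def Cell.bubble {k : ℕ} (T : Cell K) (α : Fin k → Fin n) (x : Euc n) : ℝ :=
  ∑ j : Fin k, (((x - T.center) (α j)) ^ 2 - ⨍ y in T.carrier, ((y - T.center) (α j)) ^ 2)

/-- `H²_δΛᵏ(T)`: the span of the forms `∑ⱼ ((x̃^{αⱼ})² - c^{αⱼ}) dx^{α₁} ∧ ⋯ ∧ dx^{αₖ}` over all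
increasing multi-indices `α`. -/
def H2delta (k : ℕ) (T : Cell K) : Submodule ℝ (Form n k) :=
  Submodule.span ℝ (Set.range fun (α : Fin k ↪o Fin n) (x : Euc n) => T.bubble α x • dx α)

/-- The local shape function space of `(k+1)`-forms
`P₀Λ^{k+1} + κ_T(P₀Λ^{k+2}) + ⋆κ_T⋆(P₀Λᵏ) + H²_δΛ^{k+1}(T)`. -/
def shapeSpace (k : ℕ) (T : Cell K) : Submodule ℝ (Form n (k + 1)) :=
  P0 n (k + 1) ⊔ koszulSpace (k + 1) T.center ⊔ coKoszulSpace k T.center ⊔ H2delta (k + 1) T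

/-! ### Global finite element spaces -/

/-- The piecewise constant forms `P₀Λᵏ(𝒢_h)`. -/
def P0h (K : Geometry.SimplicialComplex ℝ (Euc n)) (k : ℕ) : Submodule ℝ (PwForm K k) :=
  pwSpace fun _ => P0 n k

/-- The conforming Whitney forms `W_hΛᵏ`. -/
def Wh (Ω : Set (Euc n)) (K : Geometry.SimplicialComplex ℝ (Euc n)) (k : ℕ) :
    Set (PwForm K k) :=
  {ω | ω ∈ pwSpace (fun _ : Cell K => P1minus n k) ∧ MemH Ω (glue ω)}

/-- The discrete harmonic forms `𝔥_hΛ^{k+1}`: the kernel of `d` in `W_hΛ^{k+1}`, minus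
(orthogonally) the range of `d` on `W_hΛᵏ`. -/
def harmonic (Ω : Set (Euc n)) (K : Geometry.SimplicialComplex ℝ (Euc n)) (k : ℕ) :
    Set (PwForm K (k + 1)) :=
  {ω | ω ∈ Wh Ω K (k + 1) ∧ weakD Ω (glue ω) =ᵐ[volume.restrict Ω] 0 ∧
    ∀ τ ∈ Wh Ω K k, l2Inner Ω (glue ω) (weakD Ω (glue τ)) = 0}

/-- The space `W^{*,abc}_{h0}Λ^{k+1}` accompanying the conforming space `W_hΛᵏ`. -/
def WstarAbc (Ω : Set (Euc n)) (K : Geometry.SimplicialComplex ℝ (Euc n)) (k : ℕ) :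
    Set (PwForm K (k + 1)) :=
  {η | η ∈ pwSpace (fun _ : Cell K => P1starMinus n k) ∧
    ∀ τ ∈ Wh Ω K k,
      l2Inner Ω (glue (deltah η)) (glue τ) - l2Inner Ω (glue η) (weakD Ω (glue τ)) = 0}

/-- The nonconforming finite element space `V^{m,+δ}_{d∩δ}Λ^{k+1}`. -/
def Vh (Ω : Set (Euc n)) (K : Geometry.SimplicialComplex ℝ (Euc n)) (k : ℕ) :
    Set (PwForm K (k + 1)) :=
  {μ | μ ∈ pwSpace (fun T : Cell K => shapeSpace k T) ∧
    (∀ η ∈ WstarAbc Ω K (k + 1),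
      l2Inner Ω (glue (dh μ)) (glue η) - l2Inner Ω (glue μ) (glue (deltah η)) = 0) ∧
    ∀ τ ∈ Wh Ω K k,
      l2Inner Ω (glue (deltah μ)) (glue τ) - l2Inner Ω (glue μ) (weakD Ω (glue τ)) = 0}

/-! ### The two schemes -/

/-- `(ϑ, σ, ω)` solves the classical mixed scheme with datum `f`. -/
structure IsMixedSolution (Ω : Set (Euc n)) (K : Geometry.SimplicialComplex ℝ (Euc n)) (k : ℕ)
    (f : PwForm K (k + 1)) (ϑ : PwForm K (k + 1)) (σ : PwForm K k) (ω : PwForm K (k + 1)) :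
    Prop where
  mem_harmonic : ϑ ∈ harmonic Ω K k
  mem_sigma : σ ∈ Wh Ω K k
  mem_omega : ω ∈ Wh Ω K (k + 1)
  orth : ∀ ς ∈ harmonic Ω K k, l2Inner Ω (glue ω) (glue ς) = 0
  eq_sigma : ∀ τ ∈ Wh Ω K k,
    l2Inner Ω (glue σ) (glue τ) - l2Inner Ω (glue ω) (weakD Ω (glue τ)) = 0
  eq_omega : ∀ μ ∈ Wh Ω K (k + 1),
    l2Inner Ω (glue ϑ) (glue μ) + l2Inner Ω (weakD Ω (glue σ)) (glue μ)
      + l2Inner Ω (weakD Ω (glue ω)) (weakD Ω (glue μ)) = l2Inner Ω (glue f) (glue μ)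

/-- `(ϑ, ω)` solves the primal nonconforming scheme with datum `f`. -/
structure IsPrimalSolution (Ω : Set (Euc n)) (K : Geometry.SimplicialComplex ℝ (Euc n)) (k : ℕ)
    (f : PwForm K (k + 1)) (ϑ : PwForm K (k + 1)) (ω : PwForm K (k + 1)) : Prop where
  mem_harmonic : ϑ ∈ harmonic Ω K k
  mem_omega : ω ∈ Vh Ω K k
  orth : ∀ ς ∈ harmonic Ω K k, l2Inner Ω (glue ω) (glue ς) = 0
  eq_omega : ∀ μ ∈ Vh Ω K k,
    l2Inner Ω (glue ϑ) (glue μ) + l2Inner Ω (glue (dh ω)) (glue (dh μ))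
      + l2Inner Ω (glue (deltah ω)) (glue (deltah μ)) = l2Inner Ω (glue f) (glue μ)

end HodgeFEM

end

noncomputable section

namespace HodgeFEM

open MeasureTheory ContinuousAlternatingMap

/-! ### Alternating forms in the standard basis -/

section Algebra

variable {n k : ℕ}

/-! The schemes are linked by cellwise mean values. Derivatives of Whitney forms and of shape
functions, codifferentials of dual Whitney forms, the datum and the discrete harmonic forms are all
constant on each cell. Hence a pairing with any of these sees only the mean of the other factor; the
exceptions are pairings of two Whitney forms, such as `σ` or the codifferential of a shape function
with another of its kind.

Two facts carry the proof. Unisolvence (`exists_mem_shapeSpace`): on each cell the mean, the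
constant derivative and the codifferential (any Whitney form) of a shape function can be prescribed
independently. Duality (`IsSubdivision.exists_mem_Wh`): the pairs (mean, derivative) of conforming
Whitney forms fill a subspace `S` of a finite-dimensional inner product space. Dual Whitney forms
have free mean and codifferential, so those in `WstarAbc` represent, up to a sign, all of the
orthogonal complement of `S`. The first constraint in `Vh` then says that the pair of a
nonconforming form lies in the double complement of `S`, which is `S`: every form in `Vh` has a
conforming companion with the same mean and derivative.

Unisolvence lifts the mixed solution to a form in `Vh` with the mean and derivative of `ω` and
codifferential `σ`; testing the mixed equation with companions shows that this lift solves the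
primal equation. For the difference `e` of the primal solution and the lift, testing with `e` itself
removes the harmonic term and gives vanishing derivative and codifferential. The companion of `e` is
then harmonic, and orthogonality to harmonic forms forces the mean of `e` to vanish. A test form
with mean `ϑ' - ϑ` and zero derivatives finally gives equality of the harmonic parts. -/

theorem sum_coord_smul_stdVec (v : Euc n) : ∑ i, v i • (stdVec i : Euc n) = v := by
  ext j
  simp [stdVec, Finset.sum_apply, Pi.single_apply]

theorem clm_eq_sum {F : Type*} [AddCommGroup F] [Module ℝ F] [TopologicalSpace F]
    (L : Euc n →L[ℝ] F) (v : Euc n) : L v = ∑ i, v i • L (stdVec i) := by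
  conv_lhs => rw [← sum_coord_smul_stdVec v]
  simp

theorem alt_ext {a b : Alt n k}
    (h : ∀ f : Fin k → Fin n, a (fun i => stdVec (f i)) = b (fun i => stdVec (f i))) : a = b := by
  apply ContinuousAlternatingMap.toAlternatingMap_injective
  refine Module.Basis.ext_alternating (EuclideanSpace.basisFun (Fin n) ℝ).toBasis fun f _ => ?_
  simpa using h f

/-- The coefficients of an alternating form in the standard basis. -/
def coeffs (n k : ℕ) : Alt n k →ₗ[ℝ] ((Fin k → Fin n) → ℝ) where
  toFun a f := a (fun i => stdVec (f i))
  map_add' _ _ := rfl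
  map_smul' _ _ := rfl

theorem coeffs_injective : Function.Injective (coeffs n k) := fun _ _ h =>
  alt_ext fun f => congrFun h f

instance finiteDimensional_alt : FiniteDimensional ℝ (Alt n k) :=
  FiniteDimensional.of_injective (coeffs n k) coeffs_injective

/-- The inner product of alternating forms as a bilinear form. -/
def altBilin (n k : ℕ) : Alt n k →ₗ[ℝ] Alt n k →ₗ[ℝ] ℝ :=
  LinearMap.mk₂ ℝ altInner
    (by intro a b c; simp [altInner, add_mul, Finset.sum_add_distrib, mul_add])
    (by intro r a b; simp [altInner, Finset.mul_sum, mul_assoc, mul_left_comm])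
    (by intro a b c; simp [altInner, mul_add, Finset.sum_add_distrib])
    (by intro r a b; simp [altInner, Finset.mul_sum, mul_left_comm])

theorem altBilin_apply (a b : Alt n k) : altBilin n k a b = altInner a b := rfl

/-- The inner product of alternating forms as a continuous bilinear map. -/
def altCLM (n k : ℕ) : Alt n k →L[ℝ] Alt n k →L[ℝ] ℝ :=
  (altBilin n k).toContinuousBilinearMap

theorem altInner_comm (a b : Alt n k) : altInner a b = altInner b a := by
  simp [altInner, mul_comm]

theorem altInner_add_left (a b c : Alt n k) :
    altInner (a + b) c = altInner a c + altInner b c := by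
  simp only [← altBilin_apply, map_add, LinearMap.add_apply]

theorem altInner_smul_left (r : ℝ) (a b : Alt n k) :
    altInner (r • a) b = r * altInner a b := by
  simp only [← altBilin_apply, map_smul, LinearMap.smul_apply, smul_eq_mul]

theorem altInner_smul_right (r : ℝ) (a b : Alt n k) :
    altInner a (r • b) = r * altInner a b := by
  simp only [← altBilin_apply, map_smul, smul_eq_mul]

@[simp] theorem altInner_zero_left (a : Alt n k) : altInner 0 a = 0 := by
  simp [altInner]

@[simp] theorem altInner_zero_right (a : Alt n k) : altInner a 0 = 0 := by
  simp [altInner]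

theorem altInner_self_nonneg (a : Alt n k) : 0 ≤ altInner a a :=
  mul_nonneg (by positivity) (Finset.sum_nonneg fun _ _ => mul_self_nonneg _)

theorem altInner_self_eq_zero {a : Alt n k} (h : altInner a a = 0) : a = 0 := by
  have h1 : (Nat.factorial k : ℝ)⁻¹ ≠ 0 := by positivity
  have h2 := (mul_eq_zero.1 h).resolve_left h1
  rw [Finset.sum_eq_zero_iff_of_nonneg fun _ _ => mul_self_nonneg _] at h2
  exact alt_ext fun f => by simpa using h2 f (Finset.mem_univ f)

/-- Exterior multiplication is adjoint to contraction. -/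
theorem altInner_alternatizeUncurryFin (A : Euc n →L[ℝ] Alt n k) (t : Alt n (k + 1)) :
    altInner (alternatizeUncurryFin A) t =
      ∑ i, altInner (A (stdVec i)) (t.curryLeft (stdVec i)) := by
  -- Every slot `p` contributes the same amount: the alternatization sign cancels the sign of moving
  -- the `p`-th argument of `t` to the front. The resulting factor `k + 1` turns `1/(k+1)!` into
  -- `1/k!`.
  have key : ∀ p : Fin (k + 1),
      ∑ f : Fin (k + 1) → Fin n, ((-1 : ℝ) ^ (p : ℕ) *
        A (stdVec (f p)) (p.removeNth fun i => stdVec (f i))) * t (fun i => stdVec (f i)) =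
      ∑ i, ∑ g : Fin k → Fin n, A (stdVec i) (fun j => stdVec (g j)) *
        t.curryLeft (stdVec i) (fun j => stdVec (g j)) := by
    intro p
    rw [← (Fin.insertNthEquiv (fun _ => Fin n) p).sum_comp, Fintype.sum_prod_type]
    refine Finset.sum_congr rfl fun i _ => Finset.sum_congr rfl fun g _ => ?_
    have e1 : (p.removeNth fun j => (stdVec (p.insertNth (α := fun _ => Fin n) i g j) : Euc n)) =
        fun j => stdVec (g j) := by
      ext1 j; simp [Fin.removeNth]
    have e2 : (fun j => (stdVec (p.insertNth (α := fun _ => Fin n) i g j) : Euc n)) =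
        p.insertNth (α := fun _ => Euc n) (stdVec i) (fun j => stdVec (g j)) := by
      ext1 j
      refine Fin.succAboveCases p ?_ (fun l => ?_) j <;> simp
    have e3 : t (p.insertNth (α := fun _ => Euc n) (stdVec i) (fun j => stdVec (g j))) =
        (-1 : ℝ) ^ (p : ℕ) * t.curryLeft (stdVec i) (fun j => stdVec (g j)) := by
      simpa using t.toAlternatingMap.map_insertNth p (stdVec i) (fun j => stdVec (g j))
    simp only [Fin.insertNthEquiv_apply, Fin.insertNth_apply_same, e1]
    rw [e2, e3]
    have : ((-1 : ℝ) ^ (p : ℕ)) * (-1) ^ (p : ℕ) = 1 := by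
      rw [← mul_pow]; simp
    linear_combination (A (stdVec i) (fun j => stdVec (g j)) *
      t.curryLeft (stdVec i) (fun j => stdVec (g j))) * this
  simp only [altInner, alternatizeUncurryFin_apply, zsmul_eq_mul, Finset.sum_mul]
  push_cast
  rw [Finset.sum_comm, Finset.sum_congr rfl fun p _ => key p]
  simp only [Finset.sum_const, Finset.card_univ, Fintype.card_fin, ← Finset.mul_sum,
    Nat.factorial_succ, nsmul_eq_mul]
  have : ((k + 1 : ℕ) : ℝ) ≠ 0 := by positivity
  have h2 : (Nat.factorial k : ℝ) ≠ 0 := by positivity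
  push_cast at this ⊢
  field_simp

/-! ### The forms `dx^α` -/

theorem dx_apply (α : Fin k → Fin n) (v : Fin k → Euc n) :
    dx α v = Matrix.det (Matrix.of fun i j : Fin k => v i (α j)) := rfl

theorem dx_comp_perm (α : Fin k → Fin n) (σ : Equiv.Perm (Fin k)) :
    dx (α ∘ σ) = (Equiv.Perm.sign σ : ℝ) • dx α := by
  ext v
  exact Matrix.det_permute' σ (Matrix.of fun i j : Fin k => v i (α j))

theorem dx_eq_zero_of_not_injective {α : Fin k → Fin n} (h : ¬ Function.Injective α) :
    dx α = 0 := by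
  simp only [Function.Injective, not_forall] at h
  obtain ⟨i, j, hij, hne⟩ := h
  ext v
  exact Matrix.det_zero_of_column_eq hne fun l => by simp [hij]

theorem sum_coeffs_smul_dx (a : Alt n k) :
    ∑ f : Fin k → Fin n, a (fun i => stdVec (f i)) • dx f = (Nat.factorial k : ℝ) • a := by
  refine alt_ext fun g => ?_
  -- In the Leibniz expansion on basis vectors, the term of `σ` survives only when `f` is the
  -- rearrangement `g ∘ σ`.
  have e : ∀ f : Fin k → Fin n, dx f (fun i => stdVec (g i)) =
      ∑ σ : Equiv.Perm (Fin k), (Equiv.Perm.sign σ : ℝ) * if f = g ∘ σ then 1 else 0 := by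
    intro f
    rw [dx_apply, Matrix.det_apply']
    refine Finset.sum_congr rfl fun σ _ => ?_
    congr 1
    simp only [Matrix.of_apply, stdVec, PiLp.single_apply, Finset.prod_ite_zero,
      Finset.prod_const_one, Finset.mem_univ, true_implies, funext_iff, Function.comp_apply]
  have e2 : ∀ σ : Equiv.Perm (Fin k), a (fun i => stdVec ((g ∘ σ) i)) =
      (Equiv.Perm.sign σ : ℝ) * a (fun i => stdVec (g i)) := by
    intro σ
    have := a.toAlternatingMap.map_perm (fun i => stdVec (g i)) σ
    simpa [Units.smul_def, Function.comp_def] using this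
  calc (∑ f : Fin k → Fin n, a (fun i => stdVec (f i)) • dx f) (fun i => stdVec (g i))
      = ∑ f : Fin k → Fin n, a (fun i => stdVec (f i)) * dx f (fun i => stdVec (g i)) := by
        simp [ContinuousAlternatingMap.sum_apply]
    _ = ∑ σ : Equiv.Perm (Fin k), ∑ f : Fin k → Fin n, a (fun i => stdVec (f i)) *
          ((Equiv.Perm.sign σ : ℝ) * if f = g ∘ σ then 1 else 0) := by
        simp_rw [e, Finset.mul_sum]
        rw [Finset.sum_comm]
    _ = ∑ σ : Equiv.Perm (Fin k), a (fun i => stdVec (g i)) := by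
        refine Finset.sum_congr rfl fun σ _ => ?_
        simp only [mul_ite, mul_one, mul_zero, Finset.sum_ite_eq', Finset.mem_univ, if_true]
        rw [e2]
        have : ((Equiv.Perm.sign σ : ℤ) : ℝ) * (Equiv.Perm.sign σ : ℤ) = 1 := by
          rcases Int.units_eq_one_or (Equiv.Perm.sign σ) with h | h <;> simp [h]
        linear_combination a (fun i => stdVec (g i)) * this
    _ = _ := by simp [Fintype.card_perm]

/-- Sorting an injective tuple changes `dx` only by a sign, and a repeated index gives zero, so the
increasing multi-indices suffice. -/
theorem span_dx_eq_top :
    Submodule.span ℝ (Set.range fun α : Fin k ↪o Fin n => dx (α : Fin k → Fin n)) = ⊤ := by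
  refine (Submodule.eq_top_iff').2 fun a => ?_
  have hf : ∀ f : Fin k → Fin n, dx f ∈
      Submodule.span ℝ (Set.range fun α : Fin k ↪o Fin n => dx (α : Fin k → Fin n)) := by
    intro f
    by_cases h : Function.Injective f
    · have hm : StrictMono (f ∘ Tuple.sort f) :=
        (Tuple.monotone_sort f).strictMono_of_injective (h.comp (Tuple.sort f).injective)
      have : f = (f ∘ Tuple.sort f) ∘ (Tuple.sort f).symm := by
        ext i; simp
      rw [this, dx_comp_perm]
      exact Submodule.smul_mem _ _ (Submodule.subset_span ⟨OrderEmbedding.ofStrictMono _ hm, rfl⟩)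
    · rw [dx_eq_zero_of_not_injective h]; exact zero_mem _
  have h2 : (Nat.factorial k : ℝ) ≠ 0 := by positivity
  rw [← inv_smul_smul₀ h2 a, ← sum_coeffs_smul_dx]
  exact Submodule.smul_mem _ _ (Submodule.sum_mem _ fun f _ => Submodule.smul_mem _ _ (hf f))

theorem dx_curryLeft_stdVec_eq_zero {α : Fin (k + 1) → Fin n} {i : Fin n} (h : ∀ j, α j ≠ i) :
    (dx α).curryLeft (stdVec i) = 0 := by
  ext v
  refine Matrix.det_eq_zero_of_row_eq_zero 0 fun j => ?_
  simp [stdVec, h j]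

/-- The alternating sum is the Laplace expansion along the first column of the determinant for the
tuple `(αⱼ, α)`, in which the index `αⱼ` occurs twice. -/
theorem alternatizeUncurryFin_proj_dx (α : Fin k → Fin n) (j : Fin k) :
    alternatizeUncurryFin
      ((EuclideanSpace.proj (α j) : Euc n →L[ℝ] ℝ).smulRight (dx α)) = 0 := by
  ext v
  have := Matrix.det_succ_column_zero
    (Matrix.of fun i l : Fin (k + 1) => v i (Fin.cons (α := fun _ => Fin n) (α j) α l))
  rw [Matrix.det_zero_of_column_eq (i := 0) (j := j.succ) (Fin.succ_ne_zero j).symm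
    (fun l => by simp)] at this
  rw [alternatizeUncurryFin_apply, ContinuousAlternatingMap.coe_zero, Pi.zero_apply, this]
  refine Finset.sum_congr rfl fun p _ => ?_
  simp [dx_apply, mul_assoc]
  exact Or.inl rfl

/-! ### Contraction and exterior multiplication -/

/-- Exterior multiplication by a covector, as a function of the dual vector. -/
def wedgeCLM (a : Alt n k) : Euc n →L[ℝ] Alt n (k + 1) :=
  LinearMap.toContinuousLinearMap
    { toFun := fun v => alternatizeUncurryFin ((innerSL ℝ v).smulRight a)
      map_add' := by
        intro v w
        rw [← alternatizeUncurryFin_add]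
        congr 1
        ext; simp [add_mul]
      map_smul' := by
        intro r v
        rw [RingHom.id_apply, ← alternatizeUncurryFin_smul]
        congr 1
        ext; simp [mul_assoc] }

/-- Contracting `dxⁱ ∧ a` with `eᵢ` gives `a - dxⁱ ∧ ι_{eᵢ} a`. Summed over `i`, the first term
yields `n • a` and each of the `k` slots in the second yields `-a`. -/
theorem sum_curryLeft_wedgeCLM (a : Alt n k) :
    ∑ i : Fin n, (wedgeCLM a (stdVec i)).curryLeft (stdVec i) = ((n : ℝ) - k) • a := by
  ext v
  have hlin : ∀ p : Fin k, ∃ L : Euc n →L[ℝ] ℝ, ∀ w : Euc n,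
      L w = a (p.succ.removeNth (Fin.cons w v : Fin (k + 1) → Euc n)) := by
    intro p
    cases k with
    | zero => exact p.elim0
    | succ k =>
      refine ⟨(ContinuousAlternatingMap.apply ℝ (Euc n) ℝ (p.removeNth v)) ∘L a.curryLeft, ?_⟩
      intro w
      simp only [ContinuousLinearMap.comp_apply]
      change a (Fin.cons w (p.removeNth v)) = _
      congr 1
      ext1 j
      refine Fin.cases ?_ (fun l => ?_) j
      · simp [Fin.removeNth]
      · simp [Fin.removeNth]
  -- The tuple `(v p, v)` has equal entries in positions `0` and `p + 1`; deleting one or the other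
  -- gives the same value of `a` up to a sign.
  have hsgn : ∀ p : Fin k, (-1 : ℝ) ^ (p.succ : ℕ) *
      a (p.succ.removeNth (Fin.cons (v p) v : Fin (k + 1) → Euc n)) = - a v := by
    intro p
    have := a.toAlternatingMap.neg_one_pow_smul_map_removeNth_add_eq_zero_of_eq
      (v := (Fin.cons (v p) v : Fin (k + 1) → Euc n)) (i := 0) (j := p.succ) (by simp)
      (Fin.succ_ne_zero p).symm
    have h0 : (Fin.removeNth 0 (Fin.cons (v p) v : Fin (k + 1) → Euc n)) = v := by
      ext1 j; simp [Fin.removeNth]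
    rw [h0] at this
    simp only [Fin.val_zero, pow_zero, one_smul,
      ContinuousAlternatingMap.coe_toAlternatingMap, Int.reduceNeg, zsmul_eq_mul] at this
    push_cast at this
    linarith
  have hi : ∀ i : Fin n, (wedgeCLM a (stdVec i)).curryLeft (stdVec i) v =
      a v + ∑ p : Fin k, (-1 : ℝ) ^ (p.succ : ℕ) * (v p i *
        a (p.succ.removeNth (Fin.cons (stdVec i) v : Fin (k + 1) → Euc n))) := by
    intro i
    change (alternatizeUncurryFin _) (Fin.cons (stdVec i) v : Fin (k + 1) → Euc n) = _
    rw [alternatizeUncurryFin_apply, Fin.sum_univ_succ]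
    congr 1
    · have h0 : (Fin.removeNth 0 (Fin.cons (stdVec i) v : Fin (k + 1) → Euc n)) = v := by
        ext1 j; simp [Fin.removeNth]
      rw [h0]
      simp [stdVec]
    · refine Finset.sum_congr rfl fun p _ => ?_
      simp [stdVec, EuclideanSpace.inner_single_left]
  simp only [ContinuousAlternatingMap.sum_apply, hi, Finset.sum_add_distrib]
  rw [Finset.sum_comm]
  have : ∀ p : Fin k, ∑ i, (-1 : ℝ) ^ (p.succ : ℕ) * (v p i *
        a (p.succ.removeNth (Fin.cons (stdVec i) v : Fin (k + 1) → Euc n))) = - a v := by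
    intro p
    rw [← hsgn p, ← Finset.mul_sum]
    congr 1
    obtain ⟨L, hL⟩ := hlin p
    simp only [← hL]
    rw [clm_eq_sum L (v p)]
    rfl
  simp only [this, Finset.sum_const, Finset.card_univ, Fintype.card_fin, nsmul_eq_mul,
    ContinuousAlternatingMap.smul_apply, smul_eq_mul]
  ring

end Algebra

/-! ### Derivatives of the local shape functions -/

section Local

variable {n k : ℕ}

theorem mem_span_range_iff {V W : Type*} [AddCommGroup V] [Module ℝ V] [AddCommGroup W]
    [Module ℝ W] (f : V →ₗ[ℝ] W) (w : W) :
    w ∈ Submodule.span ℝ (Set.range f) ↔ ∃ v, f v = w := by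
  rw [← LinearMap.coe_range, Submodule.span_eq, LinearMap.mem_range]

theorem mem_P0 {ω : Form n k} : ω ∈ P0 n k ↔ ∃ a : Alt n k, (fun _ => a) = ω :=
  mem_span_range_iff
    { toFun := fun (a : Alt n k) (_ : Euc n) => a, map_add' := fun _ _ => rfl,
      map_smul' := fun _ _ => rfl } ω

theorem mem_koszulSpace {c : Euc n} {ω : Form n k} :
    ω ∈ koszulSpace k c ↔ ∃ a : Alt n (k + 1), koszul c a = ω :=
  mem_span_range_iff
    { toFun := fun a : Alt n (k + 1) => koszul c a, map_add' := fun _ _ => rfl,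
      map_smul' := fun _ _ => rfl } ω

/-- Moving the centre of the Koszul operator changes the form by a constant, so Whitney forms may be
centred at any point. -/
theorem koszul_mem_P1minus (c : Euc n) (b : Alt n (k + 1)) : koszul c b ∈ P1minus n k := by
  have : koszul c b = (fun _ => -(b.curryLeft c)) + koszul 0 b := by
    ext1 x
    simp [koszul, sub_eq_neg_add]
  rw [this]
  exact Submodule.add_mem_sup (mem_P0.2 ⟨_, rfl⟩) (mem_koszulSpace.2 ⟨b, rfl⟩)

theorem coKoszul_eq (c : Euc n) (a : Alt n k) : coKoszul c a = fun x => wedgeCLM a (x - c) := rfl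

theorem coKoszul_mem_P1starMinus (c : Euc n) (a : Alt n k) : coKoszul c a ∈ P1starMinus n k := by
  have : coKoszul c a = (fun _ => -(wedgeCLM a c)) + coKoszul 0 a := by
    ext1 x
    simp [coKoszul_eq, sub_eq_neg_add]
  rw [this]
  exact Submodule.add_mem_sup (mem_P0.2 ⟨_, rfl⟩) (Submodule.subset_span ⟨a, rfl⟩)

theorem exists_of_mem_P1minus {ω : Form n k} (h : ω ∈ P1minus n k) (c : Euc n) :
    ∃ (a : Alt n k) (b : Alt n (k + 1)), ω = (fun _ => a) + koszul c b := by
  obtain ⟨u, hu, v, hv, rfl⟩ := Submodule.mem_sup.1 h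
  obtain ⟨a, rfl⟩ := mem_P0.1 hu
  obtain ⟨b, rfl⟩ := mem_koszulSpace.1 hv
  refine ⟨a + b.curryLeft c, b, ?_⟩
  ext1 x
  simp [koszul]

theorem hasFDerivAt_clm_sub {F : Type*} [NormedAddCommGroup F] [NormedSpace ℝ F]
    (L : Euc n →L[ℝ] F) (c x : Euc n) : HasFDerivAt (fun x => L (x - c)) L x :=
  L.hasFDerivAt.comp x ((hasFDerivAt_id x).sub_const c)

theorem codiff_of_hasFDerivAt {ω : Form n (k + 1)} {x : Euc n} {L : Euc n →L[ℝ] Alt n (k + 1)}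
    (h : HasFDerivAt ω L x) : codiff ω x = -∑ i, (L (stdVec i)).curryLeft (stdVec i) := by
  simp only [codiff, h.fderiv]

theorem extDeriv_of_hasFDerivAt {ω : Form n k} {x : Euc n} {L : Euc n →L[ℝ] Alt n k}
    (h : HasFDerivAt ω L x) : extDeriv ω x = alternatizeUncurryFin L := by
  simp only [extDeriv, h.fderiv]

theorem hasFDerivAt_koszul (c : Euc n) (b : Alt n (k + 1)) (x : Euc n) :
    HasFDerivAt (koszul c b) b.curryLeft x :=
  hasFDerivAt_clm_sub b.curryLeft c x

theorem extDeriv_koszul (c : Euc n) (b : Alt n (k + 1)) :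
    extDeriv (koszul c b) = fun _ => ((k : ℝ) + 1) • b := by
  ext1 x
  rw [extDeriv_of_hasFDerivAt (hasFDerivAt_koszul c b x), alternatizeUncurryFin_curryLeft,
    ← Nat.cast_smul_eq_nsmul ℝ]
  push_cast
  rfl

theorem codiff_koszul (c : Euc n) (b : Alt n (k + 2)) : codiff (koszul c b) = 0 := by
  ext1 x
  rw [codiff_of_hasFDerivAt (hasFDerivAt_koszul c b x)]
  simp

/-- The factor `k - n` is nonzero for `k < n`; this is what makes every constant codifferential
attainable. -/
theorem codiff_coKoszul (c : Euc n) (a : Alt n k) :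
    codiff (coKoszul c a) = fun _ => ((k : ℝ) - n) • a := by
  ext1 x
  rw [coKoszul_eq, codiff_of_hasFDerivAt (hasFDerivAt_clm_sub (wedgeCLM a) c x),
    sum_curryLeft_wedgeCLM]
  module

/-- The form is exact, with potential `½‖x - c‖² a`. -/
theorem extDeriv_coKoszul (c : Euc n) (a : Alt n k) : extDeriv (coKoszul c a) = 0 := by
  have h : ∀ x : Euc n, HasFDerivAt (fun x : Euc n => ((1 / 2 : ℝ) * ‖x - c‖ ^ 2) • a)
      ((innerSL ℝ (x - c)).smulRight a) x := by
    intro x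
    have h1 := ((hasFDerivAt_id x).sub_const c).norm_sq.const_mul (1 / 2 : ℝ)
    have h2 := h1.smul_const a
    convert! h2 using 1
    ext v
    simp
  have h2 : extDeriv (fun x : Euc n => ((1 / 2 : ℝ) * ‖x - c‖ ^ 2) • a) = coKoszul c a := by
    ext1 x
    rw [extDeriv_of_hasFDerivAt (h x)]
    rfl
  rw [← h2]
  refine extDeriv_extDeriv (r := 2) ?_ ?_
  · have : ContDiff ℝ 2 fun x : Euc n => ‖x - c‖ ^ 2 := (contDiff_id.sub contDiff_const).norm_sq ℝ
    exact (contDiff_const.mul this).smul contDiff_const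
  · simp

theorem extDeriv_const (a : Alt n k) : extDeriv (fun _ : Euc n => a) = 0 := by
  ext1 x
  rw [extDeriv_of_hasFDerivAt (hasFDerivAt_const a x)]
  exact map_zero (alternatizeUncurryFinCLM ℝ (Euc n) ℝ)

theorem codiff_const (a : Alt n (k + 1)) : codiff (fun _ : Euc n => a) = 0 := by
  ext1 x
  rw [codiff_of_hasFDerivAt (hasFDerivAt_const a x)]
  simp

theorem codiff_add {ω μ : Form n (k + 1)} (h : Differentiable ℝ ω) (h' : Differentiable ℝ μ) :
    codiff (ω + μ) = codiff ω + codiff μ := by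
  ext1 x
  rw [codiff_of_hasFDerivAt ((h x).hasFDerivAt.add (h' x).hasFDerivAt)]
  simp only [codiff, _root_.add_apply, curryLeft_add, Finset.sum_add_distrib,
    neg_add, Pi.add_apply]

theorem codiff_smul (r : ℝ) {ω : Form n (k + 1)} (h : Differentiable ℝ ω) :
    codiff (r • ω) = r • codiff ω := by
  ext1 x
  rw [codiff_of_hasFDerivAt ((h x).hasFDerivAt.const_smul r)]
  simp only [codiff, _root_.smul_apply, curryLeft_smul, Pi.smul_apply, smul_neg,
    Finset.smul_sum]

theorem extDeriv_add' {ω μ : Form n k} (h : Differentiable ℝ ω) (h' : Differentiable ℝ μ) :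
    extDeriv (ω + μ) = extDeriv ω + extDeriv μ :=
  funext fun x => extDeriv_add (h x) (h' x)

theorem extDeriv_smul' (r : ℝ) (ω : Form n k) : extDeriv (r • ω) = r • extDeriv ω :=
  funext fun _ => extDeriv_smul r ω

/-! ### Subspaces cut out by conditions on the derivatives -/

/-- The `C¹` forms whose exterior derivative lies in `A`. -/
def extDerivComap (A : Submodule ℝ (Form n (k + 1))) : Submodule ℝ (Form n k) where
  carrier := {ω | ContDiff ℝ 1 ω ∧ extDeriv ω ∈ A}
  zero_mem' := ⟨contDiff_const, by
    have := extDeriv_const (n := n) (0 : Alt n k)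
    change extDeriv (fun _ : Euc n => (0 : Alt n k)) ∈ A
    rw [this]; exact zero_mem A⟩
  add_mem' := fun h h' => ⟨h.1.add h'.1, by
    rw [extDeriv_add' (h.1.differentiable one_ne_zero) (h'.1.differentiable one_ne_zero)]
    exact add_mem h.2 h'.2⟩
  smul_mem' := fun r _ h => ⟨h.1.const_smul r, by
    rw [extDeriv_smul']; exact A.smul_mem r h.2⟩

/-- The `C¹` forms whose codifferential lies in `A`. -/
def codiffComap (A : Submodule ℝ (Form n k)) : Submodule ℝ (Form n (k + 1)) where
  carrier := {ω | ContDiff ℝ 1 ω ∧ codiff ω ∈ A}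
  zero_mem' := ⟨contDiff_const, by
    have := codiff_const (n := n) (0 : Alt n (k + 1))
    change codiff (fun _ : Euc n => (0 : Alt n (k + 1))) ∈ A
    rw [this]; exact zero_mem A⟩
  add_mem' := fun h h' => ⟨h.1.add h'.1, by
    rw [codiff_add (h.1.differentiable one_ne_zero) (h'.1.differentiable one_ne_zero)]
    exact add_mem h.2 h'.2⟩
  smul_mem' := fun r _ h => ⟨h.1.const_smul r, by
    rw [codiff_smul r (h.1.differentiable one_ne_zero)]; exact A.smul_mem r h.2⟩

theorem contDiff_koszul (c : Euc n) (b : Alt n (k + 1)) : ContDiff ℝ 1 (koszul c b) :=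
  b.curryLeft.contDiff.comp (contDiff_id.sub contDiff_const)

theorem contDiff_coKoszul (c : Euc n) (a : Alt n k) : ContDiff ℝ 1 (coKoszul c a) :=
  (wedgeCLM a).contDiff.comp (contDiff_id.sub contDiff_const)

theorem P0_le_extDerivComap (A : Submodule ℝ (Form n (k + 1))) : P0 n k ≤ extDerivComap A := by
  intro ω h
  obtain ⟨a, rfl⟩ := mem_P0.1 h
  exact ⟨contDiff_const, by rw [extDeriv_const]; exact zero_mem _⟩

theorem P0_le_codiffComap (A : Submodule ℝ (Form n k)) : P0 n (k + 1) ≤ codiffComap A := by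
  intro ω h
  obtain ⟨a, rfl⟩ := mem_P0.1 h
  exact ⟨contDiff_const, by rw [codiff_const]; exact zero_mem _⟩

theorem koszulSpace_le_extDerivComap (c : Euc n) :
    koszulSpace k c ≤ extDerivComap (P0 n (k + 1)) := by
  refine Submodule.span_le.2 ?_
  rintro _ ⟨b, rfl⟩
  exact ⟨contDiff_koszul c b, mem_P0.2 ⟨_, (extDeriv_koszul c b).symm⟩⟩

theorem P1minus_le_extDerivComap : P1minus n k ≤ extDerivComap (P0 n (k + 1)) :=
  sup_le (P0_le_extDerivComap _) (koszulSpace_le_extDerivComap 0)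

theorem P1starMinus_le_codiffComap : P1starMinus n k ≤ codiffComap (P0 n k) := by
  refine sup_le (P0_le_codiffComap _) (Submodule.span_le.2 ?_)
  rintro _ ⟨b, rfl⟩
  exact ⟨contDiff_coKoszul 0 b, mem_P0.2 ⟨_, (codiff_coKoszul 0 b).symm⟩⟩

/-! ### Derivatives of the quadratic forms and of general shape functions -/

variable {K : Geometry.SimplicialComplex ℝ (Euc n)}

theorem hasFDerivAt_bubble (T : Cell K) (α : Fin k → Fin n) (x : Euc n) :
    HasFDerivAt (T.bubble α)
      (∑ j, (2 * (x - T.center) (α j)) • (EuclideanSpace.proj (α j) : Euc n →L[ℝ] ℝ)) x := by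
  refine HasFDerivAt.fun_sum fun j _ => ?_
  have h := (hasFDerivAt_clm_sub (EuclideanSpace.proj (α j) : Euc n →L[ℝ] ℝ) T.center x).pow 2
  have h2 := h.sub_const (⨍ y in T.carrier, ((y - T.center) (α j)) ^ 2)
  convert! h2 using 1
  simp

theorem contDiff_bubble (T : Cell K) (α : Fin k → Fin n) : ContDiff ℝ 1 (T.bubble α) := by
  refine ContDiff.sum fun j _ => ContDiff.sub (ContDiff.pow ?_ 2) contDiff_const
  exact (EuclideanSpace.proj (α j) : Euc n →L[ℝ] ℝ).contDiff.comp (contDiff_id.sub contDiff_const)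

/-- The bubble varies only in the directions `αⱼ`, whose covectors already occur in `dx α`. -/
theorem extDeriv_bubble (T : Cell K) (α : Fin k → Fin n) :
    extDeriv (fun x => T.bubble α x • dx α) = 0 := by
  ext1 x
  rw [extDeriv_of_hasFDerivAt ((hasFDerivAt_bubble T α x).smul_const (dx α))]
  have : (∑ j, (2 * (x - T.center) (α j)) • (EuclideanSpace.proj (α j) : Euc n →L[ℝ] ℝ)).smulRight
      (dx α) = ∑ j, (2 * (x - T.center) (α j)) •
        ((EuclideanSpace.proj (α j) : Euc n →L[ℝ] ℝ).smulRight (dx α)) := by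
    ext v w
    simp [Finset.sum_mul, mul_assoc, ContinuousAlternatingMap.sum_apply]
  rw [this, ← alternatizeUncurryFinCLM_apply, _root_.map_sum]
  refine Finset.sum_eq_zero fun j _ => ?_
  rw [map_smul, alternatizeUncurryFinCLM_apply, alternatizeUncurryFin_proj_dx, smul_zero]

/-- The derivative of the bubble along `αⱼ` is twice the centred coordinate, and contraction of `dx
α` with any direction outside `α` vanishes; the sum is therefore the contraction with `x - c_T`.
Injectivity ensures that each direction is counted once. -/
theorem codiff_bubble (T : Cell K) {α : Fin (k + 1) → Fin n} (hα : Function.Injective α) :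
    codiff (fun x => T.bubble α x • dx α) = (-2 : ℝ) • koszul T.center (dx α) := by
  ext1 x
  rw [codiff_of_hasFDerivAt ((hasFDerivAt_bubble T α x).smul_const (dx α)), Pi.smul_apply, koszul,
    clm_eq_sum (dx α).curryLeft,
    show ∀ y : Alt n k, (-2 : ℝ) • y = -((2 : ℝ) • y) from fun y => by module, Finset.smul_sum]
  congr 1
  refine Finset.sum_congr rfl fun i _ => ?_
  rw [smul_smul]
  by_cases h : ∃ j, α j = i
  · obtain ⟨j, rfl⟩ := h
    rw [ContinuousLinearMap.smulRight_apply, curryLeft_smul, _root_.smul_apply]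
    congr 1
    rw [_root_.sum_apply, Finset.sum_eq_single j]
    · simp [stdVec]
    · intro l _ hl
      simp [stdVec, hα.ne hl]
    · simp
  · push Not at h
    rw [ContinuousLinearMap.smulRight_apply, curryLeft_smul, _root_.smul_apply,
      dx_curryLeft_stdVec_eq_zero h, smul_zero, smul_zero]

theorem H2delta_le (T : Cell K) :
    H2delta (k + 1) T ≤ extDerivComap (P0 n (k + 2)) ⊓ codiffComap (P1minus n k) := by
  refine Submodule.span_le.2 ?_
  rintro _ ⟨α, rfl⟩
  have hc : ContDiff ℝ 1 fun x => T.bubble α x • dx (α : Fin (k + 1) → Fin n) :=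
    (contDiff_bubble T α).smul contDiff_const
  refine ⟨⟨hc, ?_⟩, hc, ?_⟩
  · rw [extDeriv_bubble]; exact zero_mem _
  · rw [codiff_bubble T α.injective]
    exact Submodule.smul_mem _ _ (koszul_mem_P1minus _ _)

theorem shapeSpace_le (T : Cell K) :
    shapeSpace k T ≤ extDerivComap (P0 n (k + 2)) ⊓ codiffComap (P1minus n k) := by
  refine sup_le (sup_le (sup_le (le_inf (P0_le_extDerivComap _) (P0_le_codiffComap _)) ?_) ?_)
    (H2delta_le T)
  · refine le_inf (koszulSpace_le_extDerivComap _) (Submodule.span_le.2 ?_)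
    rintro _ ⟨b, rfl⟩
    refine ⟨contDiff_koszul _ b, ?_⟩
    rw [codiff_koszul]; exact zero_mem _
  · refine Submodule.span_le.2 ?_
    rintro _ ⟨b, rfl⟩
    refine ⟨⟨contDiff_coKoszul _ b, ?_⟩, contDiff_coKoszul _ b, ?_⟩
    · rw [extDeriv_coKoszul]; exact zero_mem _
    · rw [codiff_coKoszul]
      exact Submodule.mem_sup_left (mem_P0.2 ⟨_, rfl⟩)

/-- The Koszul part of a Whitney form is recovered from its derivative, which is `k + 1` times the
contracted constant form. -/
theorem eq_const_of_extDeriv_eq_zero {ω : Form n k} (h : ω ∈ P1minus n k)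
    (hd : extDeriv ω = 0) : ∃ a : Alt n k, ω = fun _ => a := by
  obtain ⟨a, b, rfl⟩ := exists_of_mem_P1minus h 0
  have hb : ((k : ℝ) + 1) • b = 0 := by
    have h0 := congrFun hd 0
    rw [extDeriv_add' (differentiable_const a) ((contDiff_koszul 0 b).differentiable one_ne_zero),
      extDeriv_const, extDeriv_koszul] at h0
    simpa using h0
  have hb' : b = 0 := (smul_eq_zero.1 hb).resolve_left (by positivity)
  refine ⟨a, ?_⟩
  ext1 x
  simp [hb', koszul]

end Local

/-! ### Geometry of the cells and cellwise mean values -/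

section CellGeometry

variable {n : ℕ} {K : Geometry.SimplicialComplex ℝ (Euc n)}

theorem Cell.convex_carrier (T : Cell K) : Convex ℝ T.carrier := convex_convexHull ℝ _

theorem Cell.isCompact_carrier (T : Cell K) : IsCompact T.carrier :=
  T.1.finite_toSet.isCompact_convexHull ℝ

theorem Cell.interior_nonempty (T : Cell K) : (interior T.carrier).Nonempty := by
  rw [Cell.carrier, interior_convexHull_nonempty_iff_affineSpan_eq_top]
  have h := (K.indep T.2.1).affineSpan_eq_top_iff_card_eq_finrank_add_one.2
    (by simp [T.2.2])
  simpa using h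

theorem Cell.volume_interior_pos (T : Cell K) : 0 < volume (interior T.carrier) :=
  isOpen_interior.measure_pos _ T.interior_nonempty

theorem Cell.volume_carrier_lt_top (T : Cell K) : volume T.carrier < ⊤ :=
  T.isCompact_carrier.measure_lt_top

theorem Cell.volume_real_pos (T : Cell K) : 0 < volume.real T.carrier :=
  ENNReal.toReal_pos (T.volume_interior_pos.trans_le (measure_mono interior_subset)).ne'
    T.volume_carrier_lt_top.ne

theorem Cell.interior_ae_eq (T : Cell K) :
    (interior T.carrier : Set (Euc n)) =ᵐ[volume] T.carrier :=
  interior_ae_eq_of_null_frontier (T.convex_carrier.addHaar_frontier volume)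

theorem Cell.restrict_interior (T : Cell K) :
    volume.restrict (interior T.carrier) = volume.restrict T.carrier :=
  Measure.restrict_congr_set T.interior_ae_eq

/-- Two cells meet inside the convex hull of their common vertices. If that hull had interior points
there would be `n + 1` common vertices, and the cells would coincide. -/
theorem Cell.disjoint_interior {S T : Cell K} (h : S ≠ T) :
    Disjoint (interior S.carrier) (interior T.carrier) := by
  classical
  rw [Set.disjoint_iff_inter_eq_empty, ← interior_inter, ← Set.not_nonempty_iff_eq_empty]
  intro hne
  have hsub : S.carrier ∩ T.carrier ⊆ convexHull ℝ ((S.1 ∩ T.1 : Finset (Euc n)) : Set (Euc n)) := by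
    rw [Finset.coe_inter]
    exact K.inter_subset_convexHull S.2.1 T.2.1
  have h1 := hne.mono (interior_mono hsub)
  rw [interior_convexHull_nonempty_iff_affineSpan_eq_top] at h1
  have hind : AffineIndependent ℝ ((↑) : (S.1 ∩ T.1 : Finset (Euc n)) → Euc n) :=
    (K.indep S.2.1).mono (t := ((S.1 : Finset (Euc n)) : Set (Euc n))) (by
      simp)
  have h2 := hind.affineSpan_eq_top_iff_card_eq_finrank_add_one.1 (by
    rw [← h1]; congr 1; ext x; simp)
  simp only [Fintype.card_coe, finrank_euclideanSpace_fin] at h2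
  have e1 : S.1 ∩ T.1 = S.1 :=
    Finset.eq_of_subset_of_card_le Finset.inter_subset_left (by rw [h2, S.2.2])
  have e2 : S.1 ∩ T.1 = T.1 :=
    Finset.eq_of_subset_of_card_le Finset.inter_subset_right (by rw [h2, T.2.2])
  exact h (Subtype.ext (e1.symm.trans e2))

theorem Cell.integrableOn (T : Cell K) {F : Type*} [NormedAddCommGroup F] {f : Euc n → F}
    (hf : Continuous f) : IntegrableOn f T.carrier :=
  hf.continuousOn.integrableOn_compact T.isCompact_carrier

/-- The mean value of a function over a cell. -/
def Cell.mean (T : Cell K) {F : Type*} [NormedAddCommGroup F] [NormedSpace ℝ F] (f : Euc n → F) :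
    F := ⨍ y in T.carrier, f y

/-! ### Mean values over one cell -/

section Mean

variable {F : Type*} [NormedAddCommGroup F] [NormedSpace ℝ F]

theorem Cell.setIntegral_eq (T : Cell K) (f : Euc n → F) :
    ∫ x in T.carrier, f x = volume.real T.carrier • T.mean f :=
  (measure_smul_setAverage f T.volume_carrier_lt_top.ne).symm

theorem Cell.mean_eq (T : Cell K) (f : Euc n → F) :
    T.mean f = (volume.real T.carrier)⁻¹ • ∫ x in T.carrier, f x :=
  setAverage_eq _ _ _

theorem Cell.mean_add (T : Cell K) {f g : Euc n → F} (hf : Continuous f) (hg : Continuous g) :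
    T.mean (f + g) = T.mean f + T.mean g := by
  simp only [T.mean_eq, Pi.add_apply]
  rw [integral_add (T.integrableOn hf) (T.integrableOn hg), smul_add]

theorem Cell.mean_smul (T : Cell K) (r : ℝ) (f : Euc n → F) : T.mean (r • f) = r • T.mean f := by
  simp only [T.mean_eq, Pi.smul_apply]
  rw [integral_smul, smul_comm]

theorem Cell.mean_const [CompleteSpace F] (T : Cell K) (a : F) : T.mean (fun _ => a) = a := by
  rw [T.mean_eq, setIntegral_const, smul_smul, inv_mul_cancel₀ T.volume_real_pos.ne', one_smul]

theorem Cell.mean_clm {G : Type*} [NormedAddCommGroup G] [NormedSpace ℝ G] [CompleteSpace F]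
    [CompleteSpace G] (T : Cell K) (L : F →L[ℝ] G) {f : Euc n → F} (hf : Continuous f) :
    T.mean (fun x => L (f x)) = L (T.mean f) := by
  rw [T.mean_eq, T.mean_eq, L.integral_comp_comm (T.integrableOn hf), map_smul]

theorem Cell.mean_clm_sub_center [CompleteSpace F] (T : Cell K) (L : Euc n →L[ℝ] F) :
    T.mean (fun x => L (x - T.center)) = 0 := by
  rw [T.mean_clm L (by fun_prop)]
  have : T.mean (fun x : Euc n => x - T.center) = T.mean (fun x => x) + T.mean (fun _ => -T.center) := by
    rw [← T.mean_add (f := fun x : Euc n => x) (g := fun _ => -T.center) continuous_id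
      continuous_const]
    congr 1
  rw [this, T.mean_const]
  change L (T.center + _) = 0
  simp

theorem Cell.mean_bubble {k : ℕ} (T : Cell K) (α : Fin k → Fin n) : T.mean (T.bubble α) = 0 := by
  rw [T.mean_eq]
  have hc : ∀ j, Continuous fun x : Euc n => ((x - T.center) (α j)) ^ 2 := fun j => by fun_prop
  have hi : ∀ j ∈ Finset.univ, IntegrableOn (fun x : Euc n =>
      ((x - T.center) (α j)) ^ 2 - ⨍ y in T.carrier, ((y - T.center) (α j)) ^ 2) T.carrier :=
    fun j _ => T.integrableOn ((hc j).sub continuous_const)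
  simp only [Cell.bubble]
  rw [integral_finsetSum _ hi]
  rw [Finset.sum_eq_zero, smul_zero]
  intro j _
  rw [integral_sub (T.integrableOn (hc j)) (T.integrableOn continuous_const), T.setIntegral_eq,
    T.setIntegral_eq, T.mean_const]
  exact sub_self _

end Mean

variable {k : ℕ}

theorem Cell.integral_altInner_const (T : Cell K) {ω : Form n k} (hω : Continuous ω) (a : Alt n k) :
    ∫ x in T.carrier, altInner (ω x) a = volume.real T.carrier * altInner (T.mean ω) a := by
  rw [T.setIntegral_eq, smul_eq_mul]
  congr 1
  exact T.mean_clm ((altCLM n k).flip a) hω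

/-- The quadratic part of the shape space exists for this purpose: it supplies the non-constant part
of an arbitrary Whitney codifferential without affecting the mean or the exterior derivative.
Linearity reduces the claim to `e = dx α`. -/
theorem Cell.exists_H2delta (T : Cell K) (e : Alt n (k + 1)) :
    ∃ h ∈ H2delta (k + 1) T, T.mean h = 0 ∧ extDeriv h = 0 ∧ codiff h = koszul T.center e := by
  have hcd : ∀ h ∈ H2delta (k + 1) T, ContDiff ℝ 1 h := fun h hh => ((H2delta_le T) hh).1.1
  have he : e ∈ Submodule.span ℝ
      (Set.range fun α : Fin (k + 1) ↪o Fin n => dx (α : Fin (k + 1) → Fin n)) := by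
    rw [span_dx_eq_top]; trivial
  induction he using Submodule.span_induction with
  | mem x hx =>
    obtain ⟨α, rfl⟩ := hx
    refine ⟨(-2 : ℝ)⁻¹ • fun x => T.bubble α x • dx α,
      Submodule.smul_mem _ _ (Submodule.subset_span ⟨α, rfl⟩), ?_, ?_, ?_⟩
    · have := T.mean_clm (ContinuousLinearMap.toSpanSingleton ℝ (dx (α : Fin (k + 1) → Fin n)))
        (contDiff_bubble T α).continuous
      rw [T.mean_smul]
      simp only [ContinuousLinearMap.toSpanSingleton_apply] at this
      rw [this, T.mean_bubble, zero_smul, smul_zero]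
    · rw [extDeriv_smul', extDeriv_bubble, smul_zero]
    · rw [codiff_smul _ ((hcd _ (Submodule.subset_span ⟨α, rfl⟩)).differentiable one_ne_zero),
        codiff_bubble T α.injective, smul_smul]
      norm_num
  | zero =>
    refine ⟨0, zero_mem _, ?_, ?_, ?_⟩
    · exact T.mean_const 0
    · exact extDeriv_const 0
    · refine (codiff_const 0).trans ?_
      ext1 x; simp [koszul]
  | add x y _ _ hx hy =>
    obtain ⟨h, hm, h1, h2, h3⟩ := hx
    obtain ⟨h', hm', h1', h2', h3'⟩ := hy
    refine ⟨h + h', add_mem hm hm', ?_, ?_, ?_⟩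
    · rw [T.mean_add (hcd h hm).continuous (hcd h' hm').continuous, h1, h1', add_zero]
    · rw [extDeriv_add' ((hcd h hm).differentiable one_ne_zero)
        ((hcd h' hm').differentiable one_ne_zero), h2, h2', add_zero]
    · rw [codiff_add ((hcd h hm).differentiable one_ne_zero)
        ((hcd h' hm').differentiable one_ne_zero), h3, h3']
      ext1 z; simp [koszul]
  | smul r x _ hx =>
    obtain ⟨h, hm, h1, h2, h3⟩ := hx
    refine ⟨r • h, Submodule.smul_mem _ _ hm, ?_, ?_, ?_⟩
    · rw [T.mean_smul, h1, smul_zero]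
    · rw [extDeriv_smul', h2, smul_zero]
    · rw [codiff_smul _ ((hcd h hm).differentiable one_ne_zero), h3]
      ext1 z; simp [koszul]

/-- A shape function is freely prescribed by its mean value, its (constant) exterior derivative
and its codifferential. -/
theorem Cell.exists_shapeSpace (hk : k < n) (T : Cell K) (a : Alt n (k + 1)) (b : Alt n (k + 2))
    {γ : Form n k} (hγ : γ ∈ P1minus n k) :
    ∃ μ ∈ shapeSpace k T, T.mean μ = a ∧ extDeriv μ = (fun _ => b) ∧ codiff μ = γ := by
  obtain ⟨g, e, rfl⟩ := exists_of_mem_P1minus hγ T.center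
  obtain ⟨h, hm, h1, h2, h3⟩ := T.exists_H2delta e
  have hhc : ContDiff ℝ 1 h := ((H2delta_le T) hm).1.1
  have hkn : ((k : ℝ) - n) ≠ 0 := by
    have : (k : ℝ) < n := by exact_mod_cast hk
    linarith
  have hk1 : (((k + 1 : ℕ) : ℝ) + 1) ≠ 0 := by positivity
  -- The four summands act independently: the constant carries the mean, `u` the exterior derivative
  -- `b`, `v` the constant part `g` of the codifferential and `h` its Koszul part. Centring at `c_T`
  -- gives `u` and `v` mean zero.
  set u : Form n (k + 1) := koszul T.center ((((k + 1 : ℕ) : ℝ) + 1)⁻¹ • b) with hu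
  set v : Form n (k + 1) := coKoszul T.center (((k : ℝ) - n)⁻¹ • g) with hv
  have huc : ContDiff ℝ 1 u := contDiff_koszul _ _
  have hvc : ContDiff ℝ 1 v := contDiff_coKoszul _ _
  have hac : ContDiff ℝ 1 (fun _ : Euc n => a) := contDiff_const
  refine ⟨(fun _ => a) + u + v + h, ?_, ?_, ?_, ?_⟩
  · exact Submodule.add_mem_sup (Submodule.add_mem_sup (Submodule.add_mem_sup (mem_P0.2 ⟨a, rfl⟩)
      (Submodule.subset_span ⟨_, rfl⟩)) (Submodule.subset_span ⟨_, rfl⟩)) hm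
  · rw [T.mean_add ((hac.continuous.add huc.continuous).add hvc.continuous) hhc.continuous,
      T.mean_add (hac.continuous.add huc.continuous) hvc.continuous,
      T.mean_add hac.continuous huc.continuous, T.mean_const, h1]
    have e1 : T.mean u = 0 := T.mean_clm_sub_center (curryLeft ((((k + 1 : ℕ) : ℝ) + 1)⁻¹ • b))
    have e2 : T.mean v = 0 := T.mean_clm_sub_center (wedgeCLM _)
    rw [e1, e2]; simp
  · have d1 := hac.differentiable one_ne_zero
    have d2 := huc.differentiable one_ne_zero
    have d3 := hvc.differentiable one_ne_zero
    have d4 := hhc.differentiable one_ne_zero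
    rw [extDeriv_add' ((d1.add d2).add d3) d4, extDeriv_add' (d1.add d2) d3, extDeriv_add' d1 d2,
      extDeriv_const, h2, hu, hv, extDeriv_koszul, extDeriv_coKoszul, smul_smul,
      mul_inv_cancel₀ hk1, one_smul]
    simp
  · have d1 := hac.differentiable one_ne_zero
    have d2 := huc.differentiable one_ne_zero
    have d3 := hvc.differentiable one_ne_zero
    have d4 := hhc.differentiable one_ne_zero
    rw [codiff_add ((d1.add d2).add d3) d4, codiff_add (d1.add d2) d3, codiff_add d1 d2,
      codiff_const, h3, hu, hv, codiff_koszul, codiff_coKoszul, smul_smul,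
      mul_inv_cancel₀ hkn, one_smul]
    simp

/-- A dual Whitney form is freely prescribed by its mean value and its (constant)
codifferential. -/
theorem Cell.exists_P1starMinus (hk : k < n) (T : Cell K) (s : Alt n k) (t : Alt n (k + 1)) :
    ∃ η ∈ P1starMinus n k, T.mean η = t ∧ codiff η = fun _ => s := by
  have hkn : ((k : ℝ) - n) ≠ 0 := by
    have : (k : ℝ) < n := by exact_mod_cast hk
    linarith
  set v : Form n (k + 1) := coKoszul T.center (((k : ℝ) - n)⁻¹ • s) with hv
  have hvc : ContDiff ℝ 1 v := contDiff_coKoszul _ _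
  have hac : ContDiff ℝ 1 (fun _ : Euc n => t) := contDiff_const
  refine ⟨(fun _ => t) + v,
    add_mem (Submodule.mem_sup_left (mem_P0.2 ⟨t, rfl⟩)) (coKoszul_mem_P1starMinus _ _), ?_, ?_⟩
  · have e2 : T.mean v = 0 := T.mean_clm_sub_center (wedgeCLM _)
    rw [T.mean_add hac.continuous hvc.continuous, T.mean_const, e2, add_zero]
  · rw [codiff_add (hac.differentiable one_ne_zero) (hvc.differentiable one_ne_zero),
      codiff_const, hv, codiff_coKoszul, smul_smul,
      mul_inv_cancel₀ hkn, one_smul, zero_add]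

end CellGeometry

/-! ### Integrals of glued forms -/

section Glue

variable {n k : ℕ} {K : Geometry.SimplicialComplex ℝ (Euc n)} {Ω : Set (Euc n)}

theorem continuous_altInner {X : Type*} [TopologicalSpace X] {ω μ : X → Alt n k}
    (hω : Continuous ω) (hμ : Continuous μ) : Continuous fun x => altInner (ω x) (μ x) :=
  ((altCLM n k).continuous.comp hω).clm_apply hμ

/-- Contraction of alternating forms with a fixed vector. -/
def contractCLM (n k : ℕ) (v : Euc n) : Alt n (k + 1) →L[ℝ] Alt n k :=
  LinearMap.toContinuousLinearMap
    { toFun := fun t => t.curryLeft v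
      map_add' := fun _ _ => rfl
      map_smul' := fun _ _ => rfl }

theorem IsSubdivision.finite_cell (hK : IsSubdivision K Ω) : Finite (Cell K) := by
  have := hK.finite.to_subtype
  exact Finite.of_injective (fun T : Cell K => (⟨T.1, T.2.1⟩ : K.faces)) fun S T h =>
    Subtype.ext (congrArg (fun x : K.faces => x.1) h)

theorem IsSubdivision.interior_subset_domain (hK : IsSubdivision K Ω) (T : Cell K) :
    interior T.carrier ⊆ Ω := hK.interior_subset T.1 T.2.1 T.2.2

theorem IsSubdivision.subset_iUnion (hK : IsSubdivision K Ω) :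
    Ω ⊆ ⋃ T : Cell K, T.carrier := by
  intro x hx
  have h1 : x ∈ K.space := hK.space_eq ▸ subset_closure hx
  obtain ⟨s, hs, hxs⟩ := Geometry.SimplicialComplex.mem_space_iff.1 h1
  obtain ⟨t, ht, hst, hcard⟩ := hK.pure s hs
  exact Set.mem_iUnion.2 ⟨⟨t, ht, hcard⟩, convexHull_mono (by exact_mod_cast hst) hxs⟩

theorem IsSubdivision.ae_restrict (hK : IsSubdivision K Ω) {p : Euc n → Prop}
    (h : ∀ T : Cell K, ∀ᵐ x ∂volume.restrict T.carrier, p x) : ∀ᵐ x ∂volume.restrict Ω, p x := by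
  have := hK.finite_cell
  exact ae_restrict_of_ae_restrict_of_subset hK.subset_iUnion
    ((ae_restrict_iUnion_iff _ _).2 h)

theorem IsSubdivision.restrict_le (hK : IsSubdivision K Ω) (T : Cell K) :
    volume.restrict T.carrier ≤ volume.restrict Ω := by
  rw [← T.restrict_interior]
  exact Measure.restrict_mono (hK.interior_subset_domain T) le_rfl

theorem glue_apply [Fintype (Cell K)] (ω : PwForm K k) (x : Euc n) :
    glue ω x = ∑ T, Set.indicator (interior T.carrier) (ω T) x :=
  finsum_eq_sum_of_fintype _

theorem glue_of_mem [Finite (Cell K)] (ω : PwForm K k) {T : Cell K} {x : Euc n}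
    (hx : x ∈ interior T.carrier) : glue ω x = ω T x := by
  have := Fintype.ofFinite (Cell K)
  rw [glue_apply, Finset.sum_eq_single T, Set.indicator_of_mem hx]
  · intro S _ hST
    exact Set.indicator_of_notMem (Set.disjoint_right.1 (Cell.disjoint_interior hST) hx) _
  · simp

theorem glue_ae_eq [Finite (Cell K)] (ω : PwForm K k) (T : Cell K) :
    glue ω =ᵐ[volume.restrict T.carrier] ω T := by
  rw [← T.restrict_interior]
  filter_upwards [ae_restrict_mem isOpen_interior.measurableSet] with x hx
  exact glue_of_mem ω hx

theorem IsSubdivision.l2Inner_glue_left [Fintype (Cell K)] (hK : IsSubdivision K Ω)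
    (ω : PwForm K k) {g : Form n k}
    (hint : ∀ T, IntegrableOn (fun x => altInner (ω T x) (g x)) T.carrier) :
    l2Inner Ω (glue ω) g = ∑ T, ∫ x in T.carrier, altInner (ω T x) (g x) := by
  have e : ∀ x, altInner (glue ω x) (g x) =
      ∑ T, Set.indicator (interior T.carrier) (fun x => altInner (ω T x) (g x)) x := by
    intro x
    rw [glue_apply, ← altBilin_apply, _root_.map_sum, LinearMap.sum_apply]
    refine Finset.sum_congr rfl fun T _ => ?_
    by_cases hx : x ∈ interior T.carrier <;> simp [hx, altBilin_apply]
  have hm : ∀ T : Cell K, MeasurableSet (interior T.carrier) := fun T =>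
    isOpen_interior.measurableSet
  simp only [l2Inner, e]
  rw [integral_finsetSum]
  · refine Finset.sum_congr rfl fun T _ => ?_
    rw [setIntegral_indicator (hm T), Set.inter_eq_right.2 (hK.interior_subset_domain T),
      T.restrict_interior]
  · intro T _
    rw [integrable_indicator_iff (hm T), IntegrableOn, Measure.restrict_restrict (hm T),
      Set.inter_eq_left.2 (hK.interior_subset_domain T), T.restrict_interior]
    exact hint T

/-- The `L²` inner product of cellwise forms. -/
def pwInner [Fintype (Cell K)] (ω μ : PwForm K k) : ℝ :=
  ∑ T, ∫ x in T.carrier, altInner (ω T x) (μ T x)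

theorem IsSubdivision.l2Inner_glue [Fintype (Cell K)] (hK : IsSubdivision K Ω) {ω μ : PwForm K k}
    (hω : ∀ T, Continuous (ω T)) (hμ : ∀ T, Continuous (μ T)) :
    l2Inner Ω (glue ω) (glue μ) = pwInner ω μ := by
  have h : ∀ T : Cell K, (fun x => altInner (ω T x) (glue μ x)) =ᵐ[volume.restrict T.carrier]
      fun x => altInner (ω T x) (μ T x) := by
    intro T
    filter_upwards [glue_ae_eq μ T] with x hx
    rw [hx]
  rw [hK.l2Inner_glue_left]
  · exact Finset.sum_congr rfl fun T _ => integral_congr_ae (h T)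
  · intro T
    exact (T.integrableOn (continuous_altInner (hω T) (hμ T))).congr (h T).symm

theorem IsSubdivision.isL2_glue (hK : IsSubdivision K Ω) {ω : PwForm K k}
    (hω : ∀ T, Continuous (ω T)) : IsL2 Ω (glue ω) := by
  have := hK.finite_cell
  have hb : ∀ T : Cell K, ∃ C, ∀ x ∈ T.carrier, ‖ω T x‖ ≤ C := fun T =>
    T.isCompact_carrier.exists_bound_of_continuousOn (hω T).continuousOn
  choose C hC using hb
  obtain ⟨M, hM⟩ := Set.finite_range C |>.bddAbove
  have hfin : IsFiniteMeasure (volume.restrict (⋃ T : Cell K, T.carrier)) := ⟨by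
    simpa using (isCompact_iUnion fun T : Cell K => T.isCompact_carrier).measure_lt_top⟩
  refine MemLp.mono_measure (Measure.restrict_mono hK.subset_iUnion le_rfl)
    (MemLp.of_bound (AEStronglyMeasurable.iUnion fun T => ?_) M
      ((ae_restrict_iUnion_iff _ _).2 fun T => ?_))
  · exact (hω T).aestronglyMeasurable.congr (glue_ae_eq ω T).symm
  · filter_upwards [glue_ae_eq ω T, ae_restrict_mem T.isCompact_carrier.measurableSet] with x hx hxT
    rw [hx]
    exact (hC T x hxT).trans (hM ⟨T, rfl⟩)

/-! ### The weak exterior derivative of cellwise smooth forms -/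

theorem continuous_codiff {ω : Form n (k + 1)} (h : ContDiff ℝ 1 ω) : Continuous (codiff ω) := by
  have h1 : Continuous (fderiv ℝ ω) := h.continuous_fderiv one_ne_zero
  refine Continuous.neg (continuous_finsetSum _ fun i _ => ?_)
  exact (contractCLM n k (stdVec i)).continuous.comp (h1.clm_apply continuous_const)

theorem continuous_extDeriv {ω : Form n k} (h : ContDiff ℝ 1 ω) : Continuous (extDeriv ω) :=
  (alternatizeUncurryFinCLM ℝ (Euc n) ℝ).continuous.comp (h.continuous_fderiv one_ne_zero)

theorem codiff_eq_zero_of_notMem_tsupport {t : Form n (k + 1)} {x : Euc n} (hx : x ∉ tsupport t) :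
    codiff t x = 0 := by
  simp [codiff, fderiv_of_notMem_tsupport ℝ hx]

/-- Integration by parts against compactly supported forms. -/
theorem integral_altInner_codiff {ω : Form n k} {t : Form n (k + 1)} (hω : ContDiff ℝ 1 ω)
    (ht : ContDiff ℝ 1 t) (hs : HasCompactSupport t) :
    ∫ x, altInner (ω x) (codiff t x) = ∫ x, altInner (extDeriv ω x) (t x) := by
  -- Pairing `a` with the contraction of `b` by `eᵢ` expresses both integrands through partial
  -- derivatives, since contraction is adjoint to exterior multiplication; each `i` is then a
  -- one-directional integration by parts.
  let B : Fin n → (Alt n k →L[ℝ] Alt n (k + 1) →L[ℝ] ℝ) := fun i =>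
    ((altCLM n k).flip.comp (contractCLM n k (stdVec i))).flip
  have hB : ∀ i a b, B i a b = altInner a (b.curryLeft (stdVec i)) := fun _ _ _ => rfl
  have hBc : ∀ (i : Fin n) {u : Euc n → Alt n k} {v : Euc n → Alt n (k + 1)},
      Continuous u → Continuous v → HasCompactSupport v → Integrable fun x => B i (u x) (v x) := by
    intro i u v hu hv hvs
    refine (((B i).continuous.comp hu).clm_apply hv).integrable_of_hasCompactSupport ?_
    refine hvs.mono fun x hx hvx => hx ?_
    simp [hvx]
  have hω' : Continuous (fderiv ℝ ω) := hω.continuous_fderiv one_ne_zero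
  have ht' : Continuous (fderiv ℝ t) := ht.continuous_fderiv one_ne_zero
  have hωi : ∀ i : Fin n, Continuous fun x => fderiv ℝ ω x (stdVec i) := fun i =>
    hω'.clm_apply continuous_const
  have hti : ∀ i : Fin n, Continuous fun x => fderiv ℝ t x (stdVec i) := fun i =>
    ht'.clm_apply continuous_const
  have hsi : ∀ i : Fin n, HasCompactSupport fun x => fderiv ℝ t x (stdVec i) := fun i =>
    hs.fderiv_apply ℝ (stdVec i)
  have e1 : ∀ x, altInner (ω x) (codiff t x) = -∑ i, B i (ω x) (fderiv ℝ t x (stdVec i)) := by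
    intro x
    simp only [hB]
    rw [← altBilin_apply, codiff, _root_.map_neg, _root_.map_sum]
    rfl
  have e2 : ∀ x, altInner (extDeriv ω x) (t x) = ∑ i, B i (fderiv ℝ ω x (stdVec i)) (t x) := by
    intro x
    rw [extDeriv, altInner_alternatizeUncurryFin]
    rfl
  simp only [e1, e2]
  rw [integral_neg, integral_finsetSum _ fun i _ => hBc i hω.continuous (hti i) (hsi i),
    integral_finsetSum _ fun i _ => hBc i (hωi i) ht.continuous hs, ← Finset.sum_neg_distrib]
  refine Finset.sum_congr rfl fun i _ => ?_
  rw [integral_bilinear_fderiv_right_eq_neg_left_of_integrable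
    (hBc i (hωi i) ht.continuous hs) (hBc i hω.continuous (hti i) (hsi i))
    (hBc i hω.continuous ht.continuous hs)
    (fun x _ => hω.differentiable one_ne_zero x) (fun x _ => ht.differentiable one_ne_zero x),
    neg_neg]

/-- A nonzero multiple of `v` is a combination of the forms `dx f`, so `v` is orthogonal to itself.
-/
theorem altInner_dx_eq_zero {v : Alt n k} (h : ∀ f : Fin k → Fin n, altInner v (dx f) = 0) :
    v = 0 := by
  have h2 : (Nat.factorial k : ℝ) ≠ 0 := by positivity
  have h1 : altInner v ((Nat.factorial k : ℝ) • v) = 0 := by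
    rw [← sum_coeffs_smul_dx, ← altBilin_apply, _root_.map_sum]
    refine Finset.sum_eq_zero fun f _ => ?_
    rw [altBilin_apply, altInner_smul_right, h f, mul_zero]
  rw [altInner_smul_right] at h1
  exact altInner_self_eq_zero ((mul_eq_zero.1 h1).resolve_left h2)

/-- Test forms supported inside one cell do not see the jumps between cells. There the weak
derivative is the classical one by integration by parts and the fundamental lemma of the calculus of
variations, applied to each coefficient. -/
theorem IsSubdivision.weakExtDeriv_ae_eq (hK : IsSubdivision K Ω) {τ : PwForm K k}
    (hτ : ∀ T, ContDiff ℝ 1 (τ T)) {η : Form n (k + 1)} (hη : IsL2 Ω η)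
    (h : IsWeakExtDeriv Ω (glue τ) η) : η =ᵐ[volume.restrict Ω] glue (dh τ) := by
  have := hK.finite_cell
  refine hK.ae_restrict fun T => ?_
  have hfin : IsFiniteMeasure (volume.restrict T.carrier) := ⟨by
    simpa using T.volume_carrier_lt_top⟩
  have hηT : Integrable η (volume.restrict T.carrier) :=
    (hη.mono_measure (hK.restrict_le T)).integrable one_le_two
  have hdc : Continuous (extDeriv (τ T)) := continuous_extDeriv (hτ T)
  have key : ∀ f : Fin (k + 1) → Fin n, ∀ᵐ x ∂volume.restrict T.carrier,
      altInner (η x - extDeriv (τ T) x) (dx f) = 0 := by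
    intro f
    have i1 : IntegrableOn (fun x => altInner (η x) (dx f)) T.carrier :=
      ((altCLM n (k + 1)).flip (dx f)).integrable_comp hηT
    have i2 : IntegrableOn (fun x => altInner (extDeriv (τ T) x) (dx f)) T.carrier :=
      T.integrableOn (continuous_altInner hdc continuous_const)
    have hsub : ∀ x, altInner (η x - extDeriv (τ T) x) (dx f) =
        altInner (η x) (dx f) - altInner (extDeriv (τ T) x) (dx f) := fun x => by
      simp only [← altBilin_apply, _root_.map_sub, LinearMap.sub_apply]
    have hloc : LocallyIntegrableOn (fun x => altInner (η x - extDeriv (τ T) x) (dx f))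
        (interior T.carrier) volume := by
      simp only [hsub]
      exact ((i1.sub i2).mono_set _root_.interior_subset).locallyIntegrableOn
    rw [← T.restrict_interior, ae_restrict_iff' isOpen_interior.measurableSet]
    refine isOpen_interior.ae_eq_zero_of_integral_contDiff_smul_eq_zero hloc fun g hg hgs hgT => ?_
    have hz : ∀ x, x ∉ T.carrier → g x = 0 := fun x hx => by
      by_contra hne
      exact hx (_root_.interior_subset (hgT (subset_tsupport g hne)))
    set t : Form n (k + 1) := fun x => g x • dx f with ht
    have htc : ContDiff ℝ ((⊤ : ℕ∞) : WithTop ℕ∞) t := hg.smul contDiff_const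
    have htsub : tsupport t ⊆ tsupport g :=
      closure_mono fun x hx hgx => hx (by simp [ht, hgx])
    have hts : HasCompactSupport t := hgs.mono fun x hx hgx => hx (by simp [ht, hgx])
    have ht1 : ContDiff ℝ 1 t := htc.of_le (by exact_mod_cast le_top)
    have hw := h t htc hts ((htsub.trans hgT).trans (hK.interior_subset_domain T))
    have hL : l2Inner Ω (glue τ) (codiff t) = ∫ x, altInner (τ T x) (codiff t x) := by
      rw [← setIntegral_eq_integral_of_forall_compl_eq_zero (s := Ω)]
      · refine integral_congr_ae (Filter.Eventually.of_forall fun x => ?_)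
        beta_reduce
        by_cases hx : x ∈ interior T.carrier
        · rw [glue_of_mem τ hx]
        · rw [codiff_eq_zero_of_notMem_tsupport fun hx' => hx (hgT (htsub hx'))]
          simp
      · intro x hx
        rw [codiff_eq_zero_of_notMem_tsupport fun hx' =>
          hx (hK.interior_subset_domain T (hgT (htsub hx')))]
        simp
    have hR : l2Inner Ω η t = ∫ x in T.carrier, g x * altInner (η x) (dx f) := by
      rw [l2Inner, setIntegral_eq_integral_of_forall_compl_eq_zero,
        setIntegral_eq_integral_of_forall_compl_eq_zero]
      · congr 1
        ext1 x
        exact altInner_smul_right _ _ _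
      · intro x hx
        rw [hz x hx, zero_mul]
      · intro x hx
        have : g x = 0 := by
          by_contra hne
          exact hx (hK.interior_subset_domain T (hgT (subset_tsupport g hne)))
        simp [ht, this]
    rw [hL, hR, integral_altInner_codiff (hτ T) ht1 hts] at hw
    have hM : ∫ x, altInner (extDeriv (τ T) x) (t x) =
        ∫ x in T.carrier, g x * altInner (extDeriv (τ T) x) (dx f) := by
      rw [setIntegral_eq_integral_of_forall_compl_eq_zero]
      · congr 1
        ext1 x
        exact altInner_smul_right _ _ _
      · intro x hx
        rw [hz x hx, zero_mul]
    rw [hM] at hw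
    rw [← setIntegral_eq_integral_of_forall_compl_eq_zero (s := T.carrier)]
    · simp only [hsub, smul_eq_mul, mul_sub]
      rw [integral_sub, hw, sub_self]
      · exact i1.continuousOn_mul hg.continuous.continuousOn T.isCompact_carrier
      · exact i2.continuousOn_mul hg.continuous.continuousOn T.isCompact_carrier
    · intro x hx
      rw [hz x hx, zero_smul]
  filter_upwards [ae_all_iff.2 key, glue_ae_eq (dh τ) T] with x hx hgx
  rw [hgx]
  exact sub_eq_zero.1 (altInner_dx_eq_zero hx)

theorem l2Inner_congr_left {ω ω' : Form n k} (h : ω =ᵐ[volume.restrict Ω] ω') (μ : Form n k) :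
    l2Inner Ω ω μ = l2Inner Ω ω' μ := by
  refine integral_congr_ae ?_
  filter_upwards [h] with x hx
  rw [hx]

theorem l2Inner_congr_right {μ μ' : Form n k} (h : μ =ᵐ[volume.restrict Ω] μ') (ω : Form n k) :
    l2Inner Ω ω μ = l2Inner Ω ω μ' := by
  refine integral_congr_ae ?_
  filter_upwards [h] with x hx
  rw [hx]

theorem contDiff_of_mem_P1minus {τ : PwForm K k}
    (h : τ ∈ pwSpace (fun _ : Cell K => P1minus n k)) (T : Cell K) : ContDiff ℝ 1 (τ T) :=
  (P1minus_le_extDerivComap (h T trivial)).1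

theorem IsSubdivision.weakD_ae_eq (hK : IsSubdivision K Ω) {τ : PwForm K k} (hτ : τ ∈ Wh Ω K k) :
    weakD Ω (glue τ) =ᵐ[volume.restrict Ω] glue (dh τ) := by
  rw [weakD, dif_pos hτ.2.2]
  exact hK.weakExtDeriv_ae_eq (contDiff_of_mem_P1minus hτ.1) hτ.2.2.choose_spec.1
    hτ.2.2.choose_spec.2

/-- With the only possible weak derivative named explicitly, conformity becomes a linear condition
on `τ`; closure of `Wh` under sums and multiples follows from it. -/
theorem IsSubdivision.mem_Wh_iff (hK : IsSubdivision K Ω) {τ : PwForm K k} :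
    τ ∈ Wh Ω K k ↔ τ ∈ pwSpace (fun _ : Cell K => P1minus n k) ∧
      IsWeakExtDeriv Ω (glue τ) (glue (dh τ)) := by
  constructor
  · intro h
    refine ⟨h.1, ?_⟩
    obtain ⟨η, hη, hw⟩ := h.2.2
    have he := hK.weakExtDeriv_ae_eq (contDiff_of_mem_P1minus h.1) hη hw
    intro t ht hts htΩ
    rw [hw t ht hts htΩ, l2Inner_congr_left he]
  · rintro ⟨h1, h2⟩
    exact ⟨h1, hK.isL2_glue fun T => (contDiff_of_mem_P1minus h1 T).continuous, glue (dh τ),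
      hK.isL2_glue fun T => continuous_extDeriv (contDiff_of_mem_P1minus h1 T), h2⟩

end Glue

/-! ### Cellwise forms: inner products and mean values -/

section Cellwise

variable {n k : ℕ} {K : Geometry.SimplicialComplex ℝ (Euc n)} {Ω : Set (Euc n)}

/-- The cellwise mean values. -/
def meanForm (ω : PwForm K k) : Cell K → Alt n k := fun T => T.mean (ω T)

/-- The piecewise constant form with given values. -/
def constForm (a : Cell K → Alt n k) : PwForm K k := fun T _ => a T

theorem projConst_eq (ω : PwForm K k) : projConst ω = constForm (meanForm ω) := rfl

theorem continuous_constForm (a : Cell K → Alt n k) (T : Cell K) : Continuous (constForm a T) :=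
  continuous_const

theorem meanForm_constForm (a : Cell K → Alt n k) : meanForm (constForm a) = a :=
  funext fun T => T.mean_const (a T)

theorem meanForm_add {ω μ : PwForm K k} (hω : ∀ T, Continuous (ω T)) (hμ : ∀ T, Continuous (μ T)) :
    meanForm (ω + μ) = meanForm ω + meanForm μ :=
  funext fun T => T.mean_add (hω T) (hμ T)

theorem meanForm_smul (r : ℝ) (ω : PwForm K k) : meanForm (r • ω) = r • meanForm ω :=
  funext fun T => T.mean_smul r (ω T)

theorem dh_add {ω μ : PwForm K k} (hω : ∀ T, ContDiff ℝ 1 (ω T)) (hμ : ∀ T, ContDiff ℝ 1 (μ T)) :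
    dh (ω + μ) = dh ω + dh μ :=
  funext fun T => extDeriv_add' ((hω T).differentiable one_ne_zero)
    ((hμ T).differentiable one_ne_zero)

theorem dh_smul (r : ℝ) (ω : PwForm K k) : dh (r • ω) = r • dh ω :=
  funext fun T => extDeriv_smul' r (ω T)

theorem deltah_add {ω μ : PwForm K (k + 1)} (hω : ∀ T, ContDiff ℝ 1 (ω T))
    (hμ : ∀ T, ContDiff ℝ 1 (μ T)) : deltah (ω + μ) = deltah ω + deltah μ :=
  funext fun T => codiff_add ((hω T).differentiable one_ne_zero)
    ((hμ T).differentiable one_ne_zero)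

theorem deltah_smul (r : ℝ) {ω : PwForm K (k + 1)} (hω : ∀ T, ContDiff ℝ 1 (ω T)) :
    deltah (r • ω) = r • deltah ω :=
  funext fun T => codiff_smul r ((hω T).differentiable one_ne_zero)

theorem continuous_dh {ω : PwForm K k} (hω : ∀ T, ContDiff ℝ 1 (ω T)) (T : Cell K) :
    Continuous (dh ω T) := continuous_extDeriv (hω T)

theorem continuous_deltah {ω : PwForm K (k + 1)} (hω : ∀ T, ContDiff ℝ 1 (ω T)) (T : Cell K) :
    Continuous (deltah ω T) := continuous_codiff (hω T)

theorem eq_constForm_of_mem_P0h {ω : PwForm K k} (h : ω ∈ P0h K k) :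
    ω = constForm (meanForm ω) := by
  ext1 T
  obtain ⟨a, ha⟩ := mem_P0.1 (h T trivial)
  change ω T = fun _ => T.mean (ω T)
  rw [← ha, T.mean_const]

theorem dh_eq_constForm_of_P1minus {τ : PwForm K k}
    (h : τ ∈ pwSpace (fun _ : Cell K => P1minus n k)) : dh τ = constForm (meanForm (dh τ)) :=
  eq_constForm_of_mem_P0h fun T _ => (P1minus_le_extDerivComap (h T trivial)).2

theorem dh_eq_constForm_of_shapeSpace {μ : PwForm K (k + 1)}
    (h : μ ∈ pwSpace (fun T : Cell K => shapeSpace k T)) : dh μ = constForm (meanForm (dh μ)) :=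
  eq_constForm_of_mem_P0h fun T _ => (shapeSpace_le T (h T trivial)).1.2

theorem deltah_eq_constForm_of_P1starMinus {η : PwForm K (k + 1)}
    (h : η ∈ pwSpace (fun _ : Cell K => P1starMinus n k)) :
    deltah η = constForm (meanForm (deltah η)) :=
  eq_constForm_of_mem_P0h fun T _ => (P1starMinus_le_codiffComap (h T trivial)).2

theorem contDiff_of_mem_shapeSpace {μ : PwForm K (k + 1)}
    (h : μ ∈ pwSpace (fun T : Cell K => shapeSpace k T)) (T : Cell K) : ContDiff ℝ 1 (μ T) :=
  (shapeSpace_le T (h T trivial)).1.1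

theorem contDiff_of_mem_P1starMinus {η : PwForm K (k + 1)}
    (h : η ∈ pwSpace (fun _ : Cell K => P1starMinus n k)) (T : Cell K) : ContDiff ℝ 1 (η T) :=
  (P1starMinus_le_codiffComap (h T trivial)).1

/-- Applied to discrete harmonic forms, this makes all their pairings depend on mean values only. -/
theorem eq_constForm_of_dh_eq_zero {τ : PwForm K k}
    (h : τ ∈ pwSpace (fun _ : Cell K => P1minus n k)) (hd : meanForm (dh τ) = 0) :
    τ = constForm (meanForm τ) := by
  refine eq_constForm_of_mem_P0h fun T _ => ?_
  have hd' : dh τ = 0 := by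
    rw [dh_eq_constForm_of_P1minus h, hd]; rfl
  obtain ⟨a, ha⟩ := eq_const_of_extDeriv_eq_zero (h T trivial) (congrFun hd' T)
  exact mem_P0.2 ⟨a, ha.symm⟩

/-- Cellwise shape functions are freely prescribed by their mean values, their exterior
derivatives and their codifferentials. -/
theorem exists_mem_shapeSpace (hk : k < n) (a : Cell K → Alt n (k + 1))
    (b : Cell K → Alt n (k + 2)) {γ : PwForm K k}
    (hγ : γ ∈ pwSpace (fun _ : Cell K => P1minus n k)) :
    ∃ μ ∈ pwSpace (fun T : Cell K => shapeSpace k T),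
      meanForm μ = a ∧ dh μ = constForm b ∧ deltah μ = γ := by
  choose μ h1 h2 h3 h4 using fun T : Cell K =>
    T.exists_shapeSpace hk (a T) (b T) (hγ T trivial)
  exact ⟨μ, fun T _ => h1 T, funext h2, funext h3, funext h4⟩

theorem exists_mem_P1starMinus (hk : k < n) (s : Cell K → Alt n k) (t : Cell K → Alt n (k + 1)) :
    ∃ η ∈ pwSpace (fun _ : Cell K => P1starMinus n k),
      meanForm η = t ∧ deltah η = constForm s := by
  choose η h1 h2 h3 using fun T : Cell K => T.exists_P1starMinus hk (s T) (t T)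
  exact ⟨η, fun T _ => h1 T, funext h2, funext h3⟩

variable [Fintype (Cell K)]

/-- The `L²` inner product of piecewise constant forms, in terms of their values. -/
def constInner (K : Geometry.SimplicialComplex ℝ (Euc n)) [Fintype (Cell K)] (k : ℕ) :
    LinearMap.BilinForm ℝ (Cell K → Alt n k) :=
  ∑ T : Cell K, volume.real T.carrier •
    (altBilin n k).compl₁₂ (LinearMap.proj T) (LinearMap.proj T)

theorem constInner_apply (a b : Cell K → Alt n k) :
    constInner K k a b = ∑ T, volume.real T.carrier * altInner (a T) (b T) := by
  simp [constInner, altBilin_apply, LinearMap.sum_apply]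

theorem constInner_comm (a b : Cell K → Alt n k) : constInner K k a b = constInner K k b a := by
  simp only [constInner_apply, altInner_comm]

theorem constInner_self_nonneg (a : Cell K → Alt n k) : 0 ≤ constInner K k a a := by
  rw [constInner_apply]
  exact Finset.sum_nonneg fun T _ => mul_nonneg T.volume_real_pos.le (altInner_self_nonneg _)

theorem constInner_self_eq_zero {a : Cell K → Alt n k} (h : constInner K k a a = 0) : a = 0 := by
  rw [constInner_apply, Finset.sum_eq_zero_iff_of_nonneg fun T _ =>
    mul_nonneg T.volume_real_pos.le (altInner_self_nonneg _)] at h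
  ext1 T
  exact altInner_self_eq_zero
    ((mul_eq_zero.1 (h T (Finset.mem_univ T))).resolve_left T.volume_real_pos.ne')

theorem pwInner_comm (ω μ : PwForm K k) : pwInner ω μ = pwInner μ ω := by
  simp only [pwInner, altInner_comm]

theorem pwInner_constForm {ω : PwForm K k} (hω : ∀ T, Continuous (ω T)) (b : Cell K → Alt n k) :
    pwInner ω (constForm b) = constInner K k (meanForm ω) b := by
  rw [constInner_apply, pwInner]
  exact Finset.sum_congr rfl fun T _ => T.integral_altInner_const (hω T) (b T)

theorem pwInner_add_left {ω ω' μ : PwForm K k} (hω : ∀ T, Continuous (ω T))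
    (hω' : ∀ T, Continuous (ω' T)) (hμ : ∀ T, Continuous (μ T)) :
    pwInner (ω + ω') μ = pwInner ω μ + pwInner ω' μ := by
  simp only [pwInner, ← Finset.sum_add_distrib]
  refine Finset.sum_congr rfl fun T _ => ?_
  rw [← integral_add (T.integrableOn (continuous_altInner (hω T) (hμ T)))
    (T.integrableOn (continuous_altInner (hω' T) (hμ T)))]
  exact integral_congr_ae (Filter.Eventually.of_forall fun x => altInner_add_left _ _ _)

theorem pwInner_smul_left (r : ℝ) (ω μ : PwForm K k) : pwInner (r • ω) μ = r * pwInner ω μ := by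
  simp only [pwInner, Finset.mul_sum]
  refine Finset.sum_congr rfl fun T _ => ?_
  rw [← integral_const_mul]
  exact integral_congr_ae (Filter.Eventually.of_forall fun x => altInner_smul_left _ _ _)

theorem pwInner_self_nonneg (ω : PwForm K k) : 0 ≤ pwInner ω ω :=
  Finset.sum_nonneg fun _ _ => integral_nonneg fun _ => altInner_self_nonneg _

theorem ae_eq_zero_of_pwInner_self {ω : PwForm K k} (hω : ∀ T, Continuous (ω T))
    (h : pwInner ω ω = 0) (T : Cell K) : ω T =ᵐ[volume.restrict T.carrier] 0 := by
  rw [pwInner, Finset.sum_eq_zero_iff_of_nonneg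
    fun T _ => integral_nonneg fun _ => altInner_self_nonneg _] at h
  have h1 := (integral_eq_zero_iff_of_nonneg (fun x => altInner_self_nonneg (ω T x))
    (T.integrableOn (continuous_altInner (hω T) (hω T)))).1 (h T (Finset.mem_univ T))
  filter_upwards [h1] with x hx
  exact altInner_self_eq_zero hx

theorem pwInner_eq_zero_of_ae {ω : PwForm K k}
    (h : ∀ T, ω T =ᵐ[volume.restrict T.carrier] 0) (μ : PwForm K k) : pwInner ω μ = 0 := by
  refine Finset.sum_eq_zero fun T _ => integral_eq_zero_of_ae ?_
  filter_upwards [h T] with x hx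
  simp [hx]

/-! ### The finite element spaces in terms of mean values -/

theorem IsSubdivision.l2Inner_glue_add (hK : IsSubdivision K Ω) {ω μ : PwForm K k} {g : Form n k}
    (hω : ∀ T, Continuous (ω T)) (hμ : ∀ T, Continuous (μ T)) (hg : Continuous g) :
    l2Inner Ω (glue (ω + μ)) g = l2Inner Ω (glue ω) g + l2Inner Ω (glue μ) g := by
  have e : ∀ {ω : PwForm K k}, (∀ T, Continuous (ω T)) →
      l2Inner Ω (glue ω) g = pwInner ω fun _ => g := fun h =>
    hK.l2Inner_glue_left _ fun T => T.integrableOn (continuous_altInner (h T) hg)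
  rw [e hω, e hμ, e (ω := ω + μ) fun T => (hω T).add (hμ T), pwInner_add_left hω hμ fun _ => hg]

theorem IsSubdivision.l2Inner_glue_smul (hK : IsSubdivision K Ω) (r : ℝ) {ω : PwForm K k}
    {g : Form n k} (hω : ∀ T, Continuous (ω T)) (hg : Continuous g) :
    l2Inner Ω (glue (r • ω)) g = r * l2Inner Ω (glue ω) g := by
  have e : ∀ {ω : PwForm K k}, (∀ T, Continuous (ω T)) →
      l2Inner Ω (glue ω) g = pwInner ω fun _ => g := fun h =>
    hK.l2Inner_glue_left _ fun T => T.integrableOn (continuous_altInner (h T) hg)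
  rw [e hω, e (ω := r • ω) fun T => (hω T).const_smul r, pwInner_smul_left]

theorem IsSubdivision.add_mem_Wh (hK : IsSubdivision K Ω) {τ τ' : PwForm K k} (h : τ ∈ Wh Ω K k)
    (h' : τ' ∈ Wh Ω K k) : τ + τ' ∈ Wh Ω K k := by
  have hc := contDiff_of_mem_P1minus h.1
  have hc' := contDiff_of_mem_P1minus h'.1
  rw [hK.mem_Wh_iff] at h h' ⊢
  refine ⟨add_mem h.1 h'.1, fun t ht hts htΩ => ?_⟩
  have ht1 : ContDiff ℝ 1 t := ht.of_le (by exact_mod_cast le_top)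
  rw [hK.l2Inner_glue_add (fun T => (hc T).continuous) (fun T => (hc' T).continuous)
    (continuous_codiff ht1), h.2 t ht hts htΩ, h'.2 t ht hts htΩ, dh_add hc hc',
    hK.l2Inner_glue_add (continuous_dh hc)
      (continuous_dh hc') ht1.continuous]

theorem IsSubdivision.smul_mem_Wh (hK : IsSubdivision K Ω) (r : ℝ) {τ : PwForm K k}
    (h : τ ∈ Wh Ω K k) : r • τ ∈ Wh Ω K k := by
  have hc := contDiff_of_mem_P1minus h.1
  rw [hK.mem_Wh_iff] at h ⊢
  refine ⟨Submodule.smul_mem _ r h.1, fun t ht hts htΩ => ?_⟩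
  have ht1 : ContDiff ℝ 1 t := ht.of_le (by exact_mod_cast le_top)
  rw [hK.l2Inner_glue_smul r (fun T => (hc T).continuous) (continuous_codiff ht1),
    h.2 t ht hts htΩ, dh_smul,
    hK.l2Inner_glue_smul r (continuous_dh hc) ht1.continuous]

theorem IsSubdivision.zero_mem_Wh (hK : IsSubdivision K Ω) : (0 : PwForm K k) ∈ Wh Ω K k := by
  rw [hK.mem_Wh_iff]
  refine ⟨zero_mem _, fun t ht hts htΩ => ?_⟩
  have ht1 : ContDiff ℝ 1 t := ht.of_le (by exact_mod_cast le_top)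
  have h0 : ∀ T : Cell K, ContDiff ℝ 1 ((0 : PwForm K k) T) := fun T => contDiff_const
  have e : (0 : PwForm K k) = (0 : ℝ) • 0 := (smul_zero _).symm
  rw [e, dh_smul, hK.l2Inner_glue_smul 0 (fun T => (h0 T).continuous) (continuous_codiff ht1),
    hK.l2Inner_glue_smul 0 (continuous_dh h0) ht1.continuous]
  simp

theorem IsSubdivision.l2Inner_constForm (hK : IsSubdivision K Ω) {ω : PwForm K k}
    (hω : ∀ T, Continuous (ω T)) (b : Cell K → Alt n k) :
    l2Inner Ω (glue ω) (glue (constForm b)) = constInner K k (meanForm ω) b := by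
  rw [hK.l2Inner_glue hω (continuous_constForm b), pwInner_constForm hω]

theorem IsSubdivision.constForm_l2Inner (hK : IsSubdivision K Ω) {ω : PwForm K k}
    (hω : ∀ T, Continuous (ω T)) (b : Cell K → Alt n k) :
    l2Inner Ω (glue (constForm b)) (glue ω) = constInner K k b (meanForm ω) := by
  rw [hK.l2Inner_glue (continuous_constForm b) hω, pwInner_comm, pwInner_constForm hω,
    constInner_comm]

theorem IsSubdivision.l2Inner_weakD (hK : IsSubdivision K Ω) {ω : PwForm K (k + 1)}
    (hω : ∀ T, Continuous (ω T)) {τ : PwForm K k} (hτ : τ ∈ Wh Ω K k) :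
    l2Inner Ω (glue ω) (weakD Ω (glue τ)) =
      constInner K (k + 1) (meanForm ω) (meanForm (dh τ)) := by
  rw [l2Inner_congr_right (hK.weakD_ae_eq hτ), dh_eq_constForm_of_P1minus hτ.1,
    hK.l2Inner_constForm hω, meanForm_constForm]

theorem IsSubdivision.weakD_l2Inner (hK : IsSubdivision K Ω) {ω : PwForm K (k + 1)}
    (hω : ∀ T, Continuous (ω T)) {τ : PwForm K k} (hτ : τ ∈ Wh Ω K k) :
    l2Inner Ω (weakD Ω (glue τ)) (glue ω) =
      constInner K (k + 1) (meanForm (dh τ)) (meanForm ω) := by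
  rw [l2Inner_congr_left (hK.weakD_ae_eq hτ), dh_eq_constForm_of_P1minus hτ.1,
    hK.constForm_l2Inner hω, meanForm_constForm]

/-- The derivative of a Whitney form is constant on each cell, so its vanishing almost everywhere is
the vanishing of its means. -/
theorem IsSubdivision.mem_harmonic_iff (hK : IsSubdivision K Ω) {ς : PwForm K (k + 1)} :
    ς ∈ harmonic Ω K k ↔ ς ∈ Wh Ω K (k + 1) ∧ meanForm (dh ς) = 0 ∧
      ∀ τ ∈ Wh Ω K k, constInner K (k + 1) (meanForm ς) (meanForm (dh τ)) = 0 := by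
  refine and_congr_right fun hς => ?_
  have hc : ∀ T, Continuous (ς T) := fun T => (contDiff_of_mem_P1minus hς.1 T).continuous
  refine and_congr ⟨fun h => ?_, fun h => ?_⟩ (forall₂_congr fun τ hτ => by
    rw [hK.l2Inner_weakD hc hτ])
  · ext1 T
    have h1 : dh ς T =ᵐ[volume.restrict T.carrier] 0 := by
      have h2 := ((hK.weakD_ae_eq hς).symm.trans h).filter_mono (ae_mono (hK.restrict_le T))
      exact (glue_ae_eq (dh ς) T).symm.trans h2
    change T.mean (dh ς T) = 0
    rw [T.mean_eq, integral_congr_ae h1]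
    simp
  · refine (hK.weakD_ae_eq hς).trans ?_
    rw [dh_eq_constForm_of_P1minus hς.1, h]
    refine Filter.Eventually.of_forall fun x => ?_
    rw [glue_apply]
    exact Finset.sum_eq_zero fun T _ => by
      by_cases hx : x ∈ interior T.carrier <;> simp [hx, constForm]

theorem IsSubdivision.mem_WstarAbc_iff (hK : IsSubdivision K Ω) {η : PwForm K (k + 1)} :
    η ∈ WstarAbc Ω K k ↔ η ∈ pwSpace (fun _ : Cell K => P1starMinus n k) ∧
      ∀ τ ∈ Wh Ω K k, constInner K k (meanForm (deltah η)) (meanForm τ) =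
        constInner K (k + 1) (meanForm η) (meanForm (dh τ)) := by
  refine and_congr_right fun hη => forall₂_congr fun τ hτ => ?_
  rw [hK.l2Inner_weakD (fun T => (contDiff_of_mem_P1starMinus hη T).continuous) hτ,
    deltah_eq_constForm_of_P1starMinus hη, hK.constForm_l2Inner
      (fun T => (contDiff_of_mem_P1minus hτ.1 T).continuous), meanForm_constForm, sub_eq_zero]

/-- Each pairing has a piecewise constant factor, except that of `deltah μ` with `τ`: both are
affine on cells, and a full `pwInner` remains. -/
theorem IsSubdivision.mem_Vh_iff (hK : IsSubdivision K Ω) {μ : PwForm K (k + 1)} :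
    μ ∈ Vh Ω K k ↔ μ ∈ pwSpace (fun T : Cell K => shapeSpace k T) ∧
      (∀ η ∈ WstarAbc Ω K (k + 1), constInner K (k + 2) (meanForm (dh μ)) (meanForm η) =
        constInner K (k + 1) (meanForm μ) (meanForm (deltah η))) ∧
      ∀ τ ∈ Wh Ω K k, pwInner (deltah μ) τ =
        constInner K (k + 1) (meanForm μ) (meanForm (dh τ)) := by
  refine and_congr_right fun hμ => ?_
  have hc := contDiff_of_mem_shapeSpace hμ
  refine and_congr (forall₂_congr fun η hη => ?_) (forall₂_congr fun τ hτ => ?_)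
  · rw [dh_eq_constForm_of_shapeSpace hμ, hK.constForm_l2Inner
      (fun T => (contDiff_of_mem_P1starMinus hη.1 T).continuous),
      deltah_eq_constForm_of_P1starMinus hη.1, hK.l2Inner_constForm
      (fun T => (hc T).continuous), meanForm_constForm, meanForm_constForm, sub_eq_zero]
  · rw [hK.l2Inner_weakD (fun T => (hc T).continuous) hτ, hK.l2Inner_glue
      (continuous_deltah hc)
      (fun T => (contDiff_of_mem_P1minus hτ.1 T).continuous), sub_eq_zero]

theorem IsSubdivision.add_mem_Vh (hK : IsSubdivision K Ω) {μ μ' : PwForm K (k + 1)}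
    (h : μ ∈ Vh Ω K k) (h' : μ' ∈ Vh Ω K k) : μ + μ' ∈ Vh Ω K k := by
  rw [hK.mem_Vh_iff] at h h' ⊢
  have hc := contDiff_of_mem_shapeSpace h.1
  have hc' := contDiff_of_mem_shapeSpace h'.1
  refine ⟨add_mem h.1 h'.1, fun η hη => ?_, fun τ hτ => ?_⟩
  · rw [dh_add hc hc', meanForm_add (continuous_dh hc)
      (continuous_dh hc'), meanForm_add (fun T => (hc T).continuous)
      (fun T => (hc' T).continuous)]
    simp only [_root_.map_add, LinearMap.add_apply, h.2.1 η hη, h'.2.1 η hη]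
  · rw [deltah_add hc hc', pwInner_add_left (continuous_deltah hc)
      (continuous_deltah hc')
      (fun T => (contDiff_of_mem_P1minus hτ.1 T).continuous),
      meanForm_add (fun T => (hc T).continuous) (fun T => (hc' T).continuous)]
    simp only [_root_.map_add, LinearMap.add_apply, h.2.2 τ hτ, h'.2.2 τ hτ]

theorem IsSubdivision.smul_mem_Vh (hK : IsSubdivision K Ω) (r : ℝ) {μ : PwForm K (k + 1)}
    (h : μ ∈ Vh Ω K k) : r • μ ∈ Vh Ω K k := by
  rw [hK.mem_Vh_iff] at h ⊢
  have hc := contDiff_of_mem_shapeSpace h.1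
  refine ⟨Submodule.smul_mem _ r h.1, fun η hη => ?_, fun τ hτ => ?_⟩
  · rw [dh_smul, meanForm_smul, meanForm_smul]
    simp only [_root_.map_smul, LinearMap.smul_apply, h.2.1 η hη]
  · rw [deltah_smul r hc, pwInner_smul_left, meanForm_smul, h.2.2 τ hτ]
    simp only [_root_.map_smul, LinearMap.smul_apply, smul_eq_mul]

/-- For every nonconforming form there is a conforming Whitney form with the same cellwise mean
values and the same cellwise exterior derivative. -/
theorem IsSubdivision.exists_mem_Wh (hK : IsSubdivision K Ω) (hk : k + 2 ≤ n)
    {μ : PwForm K (k + 1)} (hμ : μ ∈ Vh Ω K k) :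
    ∃ τ ∈ Wh Ω K (k + 1), meanForm τ = meanForm μ ∧ meanForm (dh τ) = meanForm (dh μ) := by
  let S : Submodule ℝ ((Cell K → Alt n (k + 1)) × (Cell K → Alt n (k + 2))) :=
    { carrier := {p | ∃ τ ∈ Wh Ω K (k + 1), meanForm τ = p.1 ∧ meanForm (dh τ) = p.2}
      zero_mem' := by
        refine ⟨0, hK.zero_mem_Wh, ?_, ?_⟩
        · exact meanForm_constForm 0
        · have := dh_smul (K := K) (0 : ℝ) (0 : PwForm K (k + 1))
          rw [smul_zero, zero_smul] at this
          rw [this]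
          exact meanForm_constForm 0
      add_mem' := by
        rintro p q ⟨τ, hτ, h1, h2⟩ ⟨τ', hτ', h1', h2'⟩
        have hc := contDiff_of_mem_P1minus hτ.1
        have hc' := contDiff_of_mem_P1minus hτ'.1
        refine ⟨τ + τ', hK.add_mem_Wh hτ hτ', ?_, ?_⟩
        · rw [meanForm_add (fun T => (hc T).continuous) (fun T => (hc' T).continuous), h1, h1']
          rfl
        · rw [dh_add hc hc', meanForm_add (continuous_dh hc)
            (continuous_dh hc'), h2, h2']
          rfl
      smul_mem' := by
        rintro r p ⟨τ, hτ, h1, h2⟩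
        refine ⟨r • τ, hK.smul_mem_Wh r hτ, ?_, ?_⟩
        · rw [meanForm_smul, h1]; rfl
        · rw [dh_smul, meanForm_smul, h2]; rfl }
  let B : LinearMap.BilinForm ℝ ((Cell K → Alt n (k + 1)) × (Cell K → Alt n (k + 2))) :=
    (constInner K (k + 1)).compl₁₂ (LinearMap.fst ℝ _ _) (LinearMap.fst ℝ _ _) +
      (constInner K (k + 2)).compl₁₂ (LinearMap.snd ℝ _ _) (LinearMap.snd ℝ _ _)
  have hB : ∀ p q, B p q = constInner K (k + 1) p.1 q.1 + constInner K (k + 2) p.2 q.2 :=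
    fun _ _ => rfl
  have hsymm : ∀ p q, B p q = B q p := fun p q => by
    rw [hB, hB, constInner_comm, constInner_comm p.2]
  have hpos : ∀ p, B p p = 0 → p = 0 := fun p hp => by
    rw [hB] at hp
    have h1 := constInner_self_nonneg p.1
    have h2 := constInner_self_nonneg p.2
    exact Prod.ext (constInner_self_eq_zero (by linarith)) (constInner_self_eq_zero (by linarith))
  have hrefl : B.IsRefl := fun p q h => by rw [hsymm, h]
  have hnd : B.Nondegenerate :=
    ⟨fun p hp => hpos p (hp p), fun p hp => hpos p (hp p)⟩
  suffices h : (meanForm μ, meanForm (dh μ)) ∈ S from h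
  -- In finite dimension `S` is its own double orthogonal complement, so it suffices to test against
  -- pairs `(s, t)` orthogonal to `S`.
  rw [← LinearMap.BilinForm.orthogonal_orthogonal hnd hrefl S,
    LinearMap.BilinForm.mem_orthogonal_iff]
  rintro ⟨s, t⟩ hst
  rw [LinearMap.BilinForm.mem_orthogonal_iff] at hst
  -- The pair `(s, t)` is realised by a dual Whitney form with codifferential `s` and mean `-t`;
  -- with this sign, orthogonality to `S` is the condition defining `WstarAbc`.
  obtain ⟨η, hη, h1, h2⟩ := exists_mem_P1starMinus (K := K) (show k + 1 < n by omega) s (-t)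
  have h3 : meanForm (deltah η) = s := by rw [h2, meanForm_constForm]
  have hηW : η ∈ WstarAbc Ω K (k + 1) := by
    rw [hK.mem_WstarAbc_iff]
    refine ⟨hη, fun τ hτ => ?_⟩
    have h4 : B (meanForm τ, meanForm (dh τ)) (s, t) = 0 := hst _ ⟨τ, hτ, rfl, rfl⟩
    rw [hB] at h4
    rw [h3, h1, _root_.map_neg, LinearMap.neg_apply, constInner_comm s, constInner_comm t]
    linarith
  have h5 := ((hK.mem_Vh_iff.1 hμ).2.1 η hηW)
  rw [h1, h3, _root_.map_neg] at h5
  change B (s, t) _ = 0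
  rw [hB, constInner_comm s, constInner_comm t]
  linarith

end Cellwise

/-! ### Equivalence of the two schemes -/

section Schemes

variable {n k : ℕ} {K : Geometry.SimplicialComplex ℝ (Euc n)} {Ω : Set (Euc n)}
  {f ϑ ς : PwForm K (k + 1)} {σ : PwForm K k} {ω : PwForm K (k + 1)}

theorem continuous_of_mem_Wh {τ : PwForm K k} (h : τ ∈ Wh Ω K k) (T : Cell K) :
    Continuous (τ T) := (contDiff_of_mem_P1minus h.1 T).continuous

variable [Fintype (Cell K)]

theorem IsSubdivision.eq_constForm_of_mem_harmonic (hK : IsSubdivision K Ω)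
    (h : ς ∈ harmonic Ω K k) : ς = constForm (meanForm ς) :=
  eq_constForm_of_dh_eq_zero h.1.1 (hK.mem_harmonic_iff.1 h).2.1

theorem IsSubdivision.l2Inner_harmonic (hK : IsSubdivision K Ω) (hω : ∀ T, Continuous (ω T))
    (h : ς ∈ harmonic Ω K k) :
    l2Inner Ω (glue ω) (glue ς) = constInner K (k + 1) (meanForm ω) (meanForm ς) := by
  conv_lhs => rw [hK.eq_constForm_of_mem_harmonic h]
  exact hK.l2Inner_constForm hω _

theorem IsSubdivision.harmonic_l2Inner (hK : IsSubdivision K Ω) (hω : ∀ T, Continuous (ω T))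
    (h : ς ∈ harmonic Ω K k) :
    l2Inner Ω (glue ς) (glue ω) = constInner K (k + 1) (meanForm ς) (meanForm ω) := by
  conv_lhs => rw [hK.eq_constForm_of_mem_harmonic h]
  exact hK.constForm_l2Inner hω _

/-- A nonconforming form with the mean values and derivative of the mixed solution `ω` and with
codifferential `σ`. -/
theorem IsMixedSolution.exists_mem_Vh (hK : IsSubdivision K Ω) (hk : k + 2 ≤ n)
    (h : IsMixedSolution Ω K k f ϑ σ ω) :
    ∃ μ ∈ Vh Ω K k, meanForm μ = meanForm ω ∧ dh μ = dh ω ∧ deltah μ = σ := by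
  obtain ⟨μ, hμ, h1, h2, h3⟩ := exists_mem_shapeSpace (show k < n by omega) (meanForm ω)
    (meanForm (dh ω)) h.mem_sigma.1
  have hdh : dh μ = dh ω := by rw [h2, ← dh_eq_constForm_of_P1minus h.mem_omega.1]
  refine ⟨μ, hK.mem_Vh_iff.2 ⟨hμ, fun η hη => ?_, fun τ hτ => ?_⟩, h1, hdh, h3⟩
  -- The first constraint is the defining relation of `WstarAbc` tested with the conforming form
  -- `ω`; the second is the mixed equation for `σ`.
  · rw [hdh, h1, constInner_comm, ← (hK.mem_WstarAbc_iff.1 hη).2 ω h.mem_omega, constInner_comm]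
  · have := h.eq_sigma τ hτ
    rw [hK.l2Inner_glue (continuous_of_mem_Wh h.mem_sigma) (continuous_of_mem_Wh hτ),
      hK.l2Inner_weakD (continuous_of_mem_Wh h.mem_omega) hτ] at this
    rw [h3, h1]
    linarith

/-- The mixed solution satisfies the equation of the primal scheme. -/
theorem IsMixedSolution.primal_eq (hK : IsSubdivision K Ω) (hk : k + 2 ≤ n)
    (hf : f ∈ P0h K (k + 1)) (h : IsMixedSolution Ω K k f ϑ σ ω) {μ : PwForm K (k + 1)}
    (hμ : μ ∈ Vh Ω K k) :
    constInner K (k + 1) (meanForm ϑ) (meanForm μ) +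
      constInner K (k + 2) (meanForm (dh ω)) (meanForm (dh μ)) + pwInner (deltah μ) σ =
      constInner K (k + 1) (meanForm f) (meanForm μ) := by
  -- The conforming companion of `μ` is admissible in the mixed equation and has the same pairings
  -- there. The second constraint on `μ`, tested with `σ`, turns the term with the derivative of `σ`
  -- into the codifferential term.
  obtain ⟨τ, hτ, h1, h2⟩ := hK.exists_mem_Wh hk hμ
  have hc := continuous_of_mem_Wh hτ
  have e := h.eq_omega τ hτ
  rw [hK.harmonic_l2Inner hc h.mem_harmonic, hK.weakD_l2Inner hc h.mem_sigma,
    l2Inner_congr_left (hK.weakD_ae_eq h.mem_omega),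
    hK.l2Inner_weakD (continuous_dh (contDiff_of_mem_P1minus h.mem_omega.1)) hτ,
    eq_constForm_of_mem_P0h hf, hK.constForm_l2Inner hc, h1, h2] at e
  rw [(hK.mem_Vh_iff.1 hμ).2.2 σ h.mem_sigma, constInner_comm (meanForm μ)]
  linarith

theorem IsPrimalSolution.primal_eq (hK : IsSubdivision K Ω) (hf : f ∈ P0h K (k + 1))
    (h : IsPrimalSolution Ω K k f ϑ ω) {μ : PwForm K (k + 1)} (hμ : μ ∈ Vh Ω K k) :
    constInner K (k + 1) (meanForm ϑ) (meanForm μ) +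
      constInner K (k + 2) (meanForm (dh ω)) (meanForm (dh μ)) +
      pwInner (deltah ω) (deltah μ) =
      constInner K (k + 1) (meanForm f) (meanForm μ) := by
  have hcd := contDiff_of_mem_shapeSpace hμ.1
  have hc : ∀ T, Continuous (μ T) := fun T => (hcd T).continuous
  have e := h.eq_omega μ hμ
  rwa [hK.harmonic_l2Inner hc h.mem_harmonic, dh_eq_constForm_of_shapeSpace h.mem_omega.1,
    hK.constForm_l2Inner (continuous_dh hcd),
    hK.l2Inner_glue (continuous_deltah (contDiff_of_mem_shapeSpace h.mem_omega.1))
      (continuous_deltah hcd), eq_constForm_of_mem_P0h hf, hK.constForm_l2Inner hc] at e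

/-- The two schemes have the same solution: the harmonic parts and the mean values agree, as do
the exterior derivatives, and the codifferential of the primal solution is `σ`. -/
theorem IsMixedSolution.eq_of_isPrimalSolution (hK : IsSubdivision K Ω) (hk : k + 2 ≤ n)
    (hf : f ∈ P0h K (k + 1)) {ϑ' ω' : PwForm K (k + 1)} (ht : IsMixedSolution Ω K k f ϑ σ ω)
    (hb : IsPrimalSolution Ω K k f ϑ' ω') :
    ϑ' = ϑ ∧ (∀ T, deltah ω' T =ᵐ[volume.restrict T.carrier] σ T) ∧ dh ω' = dh ω ∧
      meanForm ω' = meanForm ω := by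
  obtain ⟨μ, hμ, hμm, hμd, hμδ⟩ := ht.exists_mem_Vh hK hk
  have hcμ := contDiff_of_mem_shapeSpace hμ.1
  have hcω' := contDiff_of_mem_shapeSpace hb.mem_omega.1
  have hμ' : (-1 : ℝ) • μ ∈ Vh Ω K k := hK.smul_mem_Vh _ hμ
  have hcμ' := contDiff_of_mem_shapeSpace hμ'.1
  set e := ω' + (-1 : ℝ) • μ with he
  have heV : e ∈ Vh Ω K k := hK.add_mem_Vh hb.mem_omega hμ'
  have hce := contDiff_of_mem_shapeSpace heV.1
  have heM : meanForm e = meanForm ω' - meanForm ω := by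
    rw [he, meanForm_add (fun T => (hcω' T).continuous) (fun T => (hcμ' T).continuous),
      meanForm_smul, hμm]
    module
  have heD : meanForm (dh e) = meanForm (dh ω') - meanForm (dh ω) := by
    rw [he, dh_add hcω' hcμ', meanForm_add (continuous_dh hcω') (continuous_dh hcμ'), dh_smul,
      meanForm_smul, hμd]
    module
  have heδ : deltah e = deltah ω' + (-1 : ℝ) • σ := by
    rw [he, deltah_add hcω' hcμ', deltah_smul _ hcμ, hμδ]
  have hδe : ∀ ν ∈ Vh Ω K k, pwInner (deltah e) (deltah ν) =
      pwInner (deltah ω') (deltah ν) - pwInner (deltah ν) σ := by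
    intro ν hν
    rw [heδ, pwInner_add_left (ω' := (-1 : ℝ) • σ) (continuous_deltah hcω')
      (fun T => (continuous_of_mem_Wh ht.mem_sigma T).const_smul (-1 : ℝ))
      (continuous_deltah (contDiff_of_mem_shapeSpace hν.1)), pwInner_smul_left,
      pwInner_comm σ]
    ring
  have hdiff : ∀ ν ∈ Vh Ω K k,
      constInner K (k + 1) (meanForm ϑ' - meanForm ϑ) (meanForm ν) +
      constInner K (k + 2) (meanForm (dh e)) (meanForm (dh ν)) +
      pwInner (deltah e) (deltah ν) = 0 := by
    intro ν hν
    have h1 := ht.primal_eq hK hk hf hν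
    have h2 := hb.primal_eq hK hf hν
    rw [hδe ν hν, heD]
    simp only [_root_.map_sub, LinearMap.sub_apply]
    linarith
  have horth : ∀ ς ∈ harmonic Ω K k, constInner K (k + 1) (meanForm e) (meanForm ς) = 0 := by
    intro ς hς
    have h1 := ht.orth ς hς
    have h2 := hb.orth ς hς
    rw [hK.l2Inner_harmonic (continuous_of_mem_Wh ht.mem_omega) hς] at h1
    rw [hK.l2Inner_harmonic (fun T => (hcω' T).continuous) hς] at h2
    rw [heM, _root_.map_sub, LinearMap.sub_apply, h1, h2, sub_zero]
  -- Energy argument: the harmonic term drops out because the mean of `e` is orthogonal to both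
  -- harmonic forms, leaving two nonnegative terms with sum zero.
  have h0 := hdiff e heV
  rw [_root_.map_sub, LinearMap.sub_apply, constInner_comm _ (meanForm e),
    constInner_comm _ (meanForm e), horth ϑ' hb.mem_harmonic, horth ϑ ht.mem_harmonic, sub_zero,
    zero_add] at h0
  have hp1 := constInner_self_nonneg (meanForm (dh e))
  have hp2 := pwInner_self_nonneg (deltah e)
  have hDe : meanForm (dh e) = 0 := constInner_self_eq_zero (by linarith)
  have hδ0 := ae_eq_zero_of_pwInner_self (continuous_deltah hce) (by linarith)
  have heM0 : meanForm e = 0 := by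
    obtain ⟨τ, hτ, h1, h2⟩ := hK.exists_mem_Wh hk heV
    -- With vanishing derivative and codifferential of `e`, its companion is closed and orthogonal
    -- to all derivatives from `Wh`. Being harmonic, it is orthogonal to `e`, whose mean it shares.
    have hτh : τ ∈ harmonic Ω K k := by
      refine hK.mem_harmonic_iff.2 ⟨hτ, h2.trans hDe, fun τ' hτ' => ?_⟩
      rw [h1, ← (hK.mem_Vh_iff.1 heV).2.2 τ' hτ', pwInner_eq_zero_of_ae hδ0]
    have h3 := horth τ hτh
    rw [h1] at h3
    exact constInner_self_eq_zero h3
  have hϑh := hK.mem_harmonic_iff.1 ht.mem_harmonic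
  have hϑh' := hK.mem_harmonic_iff.1 hb.mem_harmonic
  have hϑ : meanForm ϑ' - meanForm ϑ = 0 := by
    -- A test form with the harmonic difference as mean and zero derivatives isolates the harmonic
    -- term; it lies in `Vh` because both harmonic forms are closed and orthogonal to derivatives.
    obtain ⟨ν, hν, h1, h2, h3⟩ := exists_mem_shapeSpace (K := K) (show k < n by omega)
      (meanForm ϑ' - meanForm ϑ) 0 (zero_mem (pwSpace fun _ : Cell K => P1minus n k))
    have hdν : meanForm (dh ν) = 0 := by rw [h2, meanForm_constForm]
    have hνV : ν ∈ Vh Ω K k := by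
      refine hK.mem_Vh_iff.2 ⟨hν, fun η hη => ?_, fun τ hτ => ?_⟩
      · have hη' := (hK.mem_WstarAbc_iff.1 hη).2
        rw [hdν, h1, constInner_comm _ (meanForm (deltah η)), _root_.map_sub,
          hη' _ hϑh'.1, hη' _ hϑh.1, hϑh.2.1, hϑh'.2.1]
        simp
      · rw [h3, h1, _root_.map_sub, LinearMap.sub_apply, hϑh.2.2 τ hτ, hϑh'.2.2 τ hτ, sub_zero]
        exact pwInner_eq_zero_of_ae (fun T => Filter.EventuallyEq.rfl) τ
    have h4 := hdiff ν hνV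
    rw [h1, hDe, pwInner_eq_zero_of_ae hδ0] at h4
    simp only [_root_.map_zero, LinearMap.zero_apply, add_zero] at h4
    exact constInner_self_eq_zero h4
  refine ⟨?_, fun T => ?_, ?_, sub_eq_zero.1 (heM.symm.trans heM0)⟩
  · rw [hK.eq_constForm_of_mem_harmonic hb.mem_harmonic,
      hK.eq_constForm_of_mem_harmonic ht.mem_harmonic, sub_eq_zero.1 hϑ]
  · have h1 := hδ0 T
    rw [heδ] at h1
    filter_upwards [h1] with x hx
    have hx' : deltah ω' T x + (-1 : ℝ) • σ T x = 0 := hx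
    have hx2 : deltah ω' T x - σ T x = deltah ω' T x + (-1 : ℝ) • σ T x := by module
    exact sub_eq_zero.1 (hx2.trans hx')
  · rw [dh_eq_constForm_of_shapeSpace hb.mem_omega.1, dh_eq_constForm_of_P1minus ht.mem_omega.1,
      sub_eq_zero.1 (heD.symm.trans hDe)]

end Schemes

end HodgeFEM

end

theorem mainTheorem5 (n k : ℕ) (hk : k + 2 ≤ n) (Ω : Set (HodgeFEM.Euc n)) (hΩ : IsOpen Ω)
    (K : Geometry.SimplicialComplex ℝ (HodgeFEM.Euc n)) (hK : HodgeFEM.IsSubdivision K Ω)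
    (f₀ : HodgeFEM.PwForm K (k + 1)) (hf₀ : f₀ ∈ HodgeFEM.P0h K (k + 1))
    (ϑt : HodgeFEM.PwForm K (k + 1)) (σt : HodgeFEM.PwForm K k) (ωt : HodgeFEM.PwForm K (k + 1))
    (ht : HodgeFEM.IsMixedSolution Ω K k f₀ ϑt σt ωt)
    (ϑb ωb : HodgeFEM.PwForm K (k + 1))
    (hb : HodgeFEM.IsPrimalSolution Ω K k f₀ ϑb ωb) :
    HodgeFEM.glue ϑb =ᵐ[MeasureTheory.volume.restrict Ω] HodgeFEM.glue ϑt ∧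
    HodgeFEM.glue (HodgeFEM.deltah ωb) =ᵐ[MeasureTheory.volume.restrict Ω] HodgeFEM.glue σt ∧
    HodgeFEM.glue (HodgeFEM.dh ωb) =ᵐ[MeasureTheory.volume.restrict Ω]
      HodgeFEM.weakD Ω (HodgeFEM.glue ωt) ∧
    HodgeFEM.glue (HodgeFEM.projConst ωb) =ᵐ[MeasureTheory.volume.restrict Ω]
      HodgeFEM.glue (HodgeFEM.projConst ωt) := by
  have := hK.finite_cell
  have := Fintype.ofFinite (HodgeFEM.Cell K)
  obtain ⟨h1, h2, h3, h4⟩ := ht.eq_of_isPrimalSolution hK hk hf₀ hb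
  -- Only the codifferential identity is known merely almost everywhere on each cell; the finitely
  -- many cells cover `Ω`, so it passes to the glued forms.
  refine ⟨by rw [h1], hK.ae_restrict fun T => ?_, ?_, ?_⟩
  · filter_upwards [HodgeFEM.glue_ae_eq (HodgeFEM.deltah ωb) T, HodgeFEM.glue_ae_eq σt T, h2 T]
      with x hx1 hx2 hx3
    rw [hx1, hx2, hx3]
  · rw [h3]
    exact (hK.weakD_ae_eq ht.mem_omega).symm
  · rw [HodgeFEM.projConst_eq, HodgeFEM.projConst_eq, h4]
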